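/- Let $\mathbb S^1=\mathbb R/\mathbb Z$, let $\alpha\in\mathbb R$ be a Liouville number, and let $\mathcal H^\infty_\alpha$ be the set of orientation-preserving $C^\infty$ diffeomorphisms of $\mathbb S^1$ with rotation number $\alpha \bmod 1$, equipped with the $C^\infty$ topology (uniform convergence of the maps, of their inverses, and of all derivatives of both) and its Borel $\sigma$-algebra. Let $\mathcal D$ be a class of orientation-preserving homeomorphisms of $\mathbb S^1$ of any degree of regularity from Hölder to $C^\infty$; that is, $\mathcal D$ is any class that contains every orientation-preserving $C^\infty$ diffeomorphism of $\mathbb S^1$ and all of whose members are Hölder continuous with some exponent in $(0,1)$ (the exponent may depend on the member). Examples are the class of all Hölder homeomorphisms, and the classes of $C^k$ diffeomorphisms and of $C^{k}$ diffeomorphisms with $\beta$-Hölder continuous $k$-th derivative, for $1\le k<\infty$ and $0<\beta<1$, and the class of $C^\infty$ diffeomorphisms, all orientation-preserving. Then there is no complete numerical Borel invariant for $\mathcal D$-conjugacy on $\mathcal H^\infty_\alpha$: there is no Borel function $\varphi:\mathcal H^\infty_\alpha\to\mathbb R$ such that for all $S,T\in\mathcal H^\infty_\alpha$ $$\varphi(S)=\varphi(T)\iff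 S=h\circ T\circ h^{-1}\ \text{ for some } h\in\mathcal D .$$ -/

import Mathlib

open scoped ContDiff Topology UniformConvergence

/-- `F` is a lift of the circle map `f : ℝ/ℤ → ℝ/ℤ`: a continuous nondecreasing function with
`F (x + 1) = F x + 1` (both part of `CircleDeg1Lift`, except continuity) and `[F x] = f [x]`. -/
def IsCircleLift (F : CircleDeg1Lift) (f : UnitAddCircle → UnitAddCircle) : Prop :=
  Continuous F ∧ ∀ x : ℝ, ((F x : ℝ) : UnitAddCircle) = f (x : UnitAddCircle)

/-- Two lifts of the same circle map differ by an integer constant. -/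
theorem IsCircleLift.exists_int {F G : CircleDeg1Lift} {f : UnitAddCircle → UnitAddCircle}
    (hF : IsCircleLift F f) (hG : IsCircleLift G f) : ∃ n : ℤ, ∀ x, F x = G x + n := by
  have key : ∀ x : ℝ, ∃ n : ℤ, (n : ℝ) = F x - G x := by
    intro x
    have h : ((F x - G x : ℝ) : UnitAddCircle) = 0 := by
      rw [AddCircle.coe_sub, hF.2, hG.2, sub_self]
    obtain ⟨n, hn⟩ := (AddCircle.coe_eq_zero_iff (1 : ℝ)).1 h
    exact ⟨n, by simpa using hn⟩
  choose n hn using key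
  have hc : Continuous n := by
    rw [Int.isClosedEmbedding_coe_real.isEmbedding.continuous_iff]
    have h : (Int.cast ∘ n : ℝ → ℝ) = fun x => F x - G x := funext hn
    rw [h]
    exact hF.1.sub hG.1
  refine ⟨n 0, fun x => ?_⟩
  have h0 : n x = n 0 := PreconnectedSpace.constant inferInstance hc
  have := hn x
  rw [h0] at this
  linarith

/-- Derivatives of positive order of a lift do not depend on the lift. -/
theorem IsCircleLift.iteratedDeriv_eq {F G : CircleDeg1Lift} {f : UnitAddCircle → UnitAddCircle}
    (hF : IsCircleLift F f) (hG : IsCircleLift G f) (k : ℕ) :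
    iteratedDeriv (k + 1) F = iteratedDeriv (k + 1) G := by
  obtain ⟨n, hn⟩ := hF.exists_int hG
  have : (F : ℝ → ℝ) = fun x => G x + (n : ℝ) := funext hn
  rw [this, iteratedDeriv_succ', iteratedDeriv_succ']
  congr 1
  funext x
  simp

/-- The orientation-preserving homeomorphisms of the circle `ℝ/ℤ`. -/
def circleHomeos : Set (UnitAddCircle ≃ₜ UnitAddCircle) :=
  {f | ∃ F, IsCircleLift F f}

/-- The orientation-preserving `C^∞` diffeomorphisms of the circle: `f` and `f⁻¹` are both smooth
(smoothness is tested on lifts to `ℝ`). -/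
def smoothCircleDiffeos : Set (UnitAddCircle ≃ₜ UnitAddCircle) :=
  {f | (∃ F, IsCircleLift F f ∧ ContDiff ℝ ∞ F) ∧ ∃ G, IsCircleLift G f.symm ∧ ContDiff ℝ ∞ G}

/-- The orientation-preserving homeomorphisms of the circle which are Hölder continuous with some
exponent in `(0, 1)`. -/
def holderCircleHomeos : Set (UnitAddCircle ≃ₜ UnitAddCircle) :=
  {f | f ∈ circleHomeos ∧ ∃ C β : NNReal, 0 < β ∧ β < 1 ∧ HolderWith C β f}

/-- `𝒟` is a class of orientation-preserving circle homeomorphisms of some degree of regularity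
between Hölder and `C^∞`. -/
def IsRegularityClass (𝒟 : Set (UnitAddCircle ≃ₜ UnitAddCircle)) : Prop :=
  smoothCircleDiffeos ⊆ 𝒟 ∧ 𝒟 ⊆ holderCircleHomeos

/-- The space of orientation-preserving `C^∞` diffeomorphisms of the circle. -/
def SmoothCircleDiffeo : Type := smoothCircleDiffeos

namespace SmoothCircleDiffeo

/-- The underlying homeomorphism of the circle. -/
def toHomeo (f : SmoothCircleDiffeo) : UnitAddCircle ≃ₜ UnitAddCircle := f.1

/-- A smooth lift of `f`. -/
noncomputable def lift (f : SmoothCircleDiffeo) : CircleDeg1Lift := f.2.1.choose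

theorem lift_spec (f : SmoothCircleDiffeo) :
    IsCircleLift f.lift f.toHomeo ∧ ContDiff ℝ ∞ f.lift := f.2.1.choose_spec

/-- The inverse diffeomorphism. -/
def inv (f : SmoothCircleDiffeo) : SmoothCircleDiffeo := ⟨f.1.symm, f.2.2, f.2.1⟩

/-- The `C^∞` topology: the coarsest one for which `f` and all its derivatives, and `f⁻¹` and all
its derivatives, depend continuously on `f` in the sense of uniform convergence. -/
noncomputable instance : TopologicalSpace SmoothCircleDiffeo :=
  (TopologicalSpace.induced (fun f => UniformFun.ofFun (f.toHomeo : UnitAddCircle → UnitAddCircle))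
      inferInstance ⊓
    ⨅ k : ℕ, TopologicalSpace.induced
      (fun f => UniformFun.ofFun (iteratedDeriv (k + 1) f.lift)) inferInstance) ⊓
  (TopologicalSpace.induced
      (fun f => UniformFun.ofFun (f.inv.toHomeo : UnitAddCircle → UnitAddCircle)) inferInstance ⊓
    ⨅ k : ℕ, TopologicalSpace.induced
      (fun f => UniformFun.ofFun (iteratedDeriv (k + 1) f.inv.lift)) inferInstance)

end SmoothCircleDiffeo

/-- `ρ ∈ ℝ/ℤ` is the rotation number of `f`: the class modulo `1` of
`lim (F^n x - x) / n` for a lift `F` of `f`. -/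
def HasRotationNumber (f : UnitAddCircle → UnitAddCircle) (ρ : UnitAddCircle) : Prop :=
  ∃ F, IsCircleLift F f ∧ ((F.translationNumber : ℝ) : UnitAddCircle) = ρ

/-- The space of orientation-preserving `C^∞` circle diffeomorphisms with rotation number `ρ`,
with the topology induced from the space of all such diffeomorphisms. -/
abbrev SmoothCircleDiffeoOfRotation (ρ : UnitAddCircle) : Type :=
  {f : SmoothCircleDiffeo // HasRotationNumber f.toHomeo ρ}

/-- `S` and `T` are `𝒟`-conjugate: `S = h ∘ T ∘ h⁻¹` for some `h ∈ 𝒟`. -/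
def ConjugateBy (𝒟 : Set (UnitAddCircle ≃ₜ UnitAddCircle))
    (S T : UnitAddCircle ≃ₜ UnitAddCircle) : Prop :=
  ∃ h ∈ 𝒟, ∀ x, S x = h (T (h.symm x))

/-- `φ : X → ℝ` is a complete numerical Borel invariant for the relation `E` on `X`. -/
def IsCompleteNumericalBorelInvariant {X : Type*} [TopologicalSpace X] (E : X → X → Prop)
    (φ : X → ℝ) : Prop :=
  @Measurable X ℝ (borel X) (borel ℝ) φ ∧ ∀ x y, E x y ↔ φ x = φ y

/-! The proof is an Anosov–Katok construction indexed by binary sequences, followed by a zero-one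
law.

Let f be the lift through x ↦ qx of a hyperbolic Möbius map with parameter r. It commutes with the
rotation by 1/q, so conjugating R_α by f only sees the displacement qα - p. For Liouville α this
displacement beats every power of q, while taking 1 - r to be a power of 1/q costs only powers of q.
Hence f can contract an interval of length 1/(2q) to length at most q^{-n} and still move R_α very
little in C^n (`Liouville.exists_contracting_perturbation`).

Choose such f_n inductively. For x in {0,1}^ℕ let H_{x,n} be the product of those f_i with i < n and
x_i = 1. The conjugates of R_α by H_{x,n} converge smoothly to a diffeomorphism S_x that depends
continuously on x, and H_{x,n} converges uniformly to a semiconjugacy H_x from R_α to S_x.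

If x and y agree from some index on, their common tail cancels in H_{x,m} H_{y,m}⁻¹, so S_x and S_y
are smoothly conjugate (`ContractingSequence.limit_conj`). If x_n = 0 and y_n = 1 infinitely often,
no Hölder h conjugates S_y to S_x: since α is irrational, h ∘ H_y = H_x ∘ R_θ on the circle, yet at
such n the map H_y contracts an interval to q^{-(n-2)} while H_x keeps every translate of it at size
at least 1/(4q²) (`ContractingSequence.not_conjugateBy`).

A complete invariant φ would make x ↦ φ(S_x) a measurable tail function, hence almost surely
constant for fair coin tosses. Flipping all coordinates preserves the measure, so some x and its
complement have the same value, although they differ everywhere (`exists_eq_of_tail_invariant`). -/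

open Filter Set Function

/-! ### Calculus of C^n convergence on the line -/

section UniformSmoothConvergence

variable {ι : Type*} {l : Filter ι}

/-- Uniform convergence on `ℝ` of functions together with their first `n` derivatives. -/
def TendstoC (l : Filter ι) : ℕ → (ι → ℝ → ℝ) → (ℝ → ℝ) → Prop
  | 0, F, f => TendstoUniformly F f l
  | n + 1, F, f => TendstoUniformly F f l ∧ TendstoC l n (fun i => deriv (F i)) (deriv f)

theorem TendstoC.tendstoUniformly {n : ℕ} {F : ι → ℝ → ℝ} {f : ℝ → ℝ} (h : TendstoC l n F f) :
    TendstoUniformly F f l := by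
  cases n with
  | zero => exact h
  | succ n => exact h.1

theorem TendstoC.of_succ {n : ℕ} {F : ι → ℝ → ℝ} {f : ℝ → ℝ} (h : TendstoC l (n + 1) F f) :
    TendstoC l n F f := by
  induction n generalizing F f with
  | zero => exact h.1
  | succ n ih => exact ⟨h.1, ih h.2⟩

theorem TendstoC.iteratedDeriv {n k : ℕ} (hk : k ≤ n) {F : ι → ℝ → ℝ} {f : ℝ → ℝ}
    (h : TendstoC l n F f) :
    TendstoUniformly (fun i => iteratedDeriv k (F i)) (iteratedDeriv k f) l := by
  induction k generalizing n F f with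
  | zero => simpa using h.tendstoUniformly
  | succ k ih =>
    obtain ⟨n, rfl⟩ : ∃ m, n = m + 1 := ⟨n - 1, by omega⟩
    simpa only [iteratedDeriv_succ'] using ih (by omega) h.2

theorem TendstoC.const (n : ℕ) (f : ℝ → ℝ) : TendstoC l n (fun _ => f) f := by
  have key : ∀ f : ℝ → ℝ, TendstoUniformly (fun _ : ι => f) f l := fun f =>
    Metric.tendstoUniformly_iff.2 fun ε hε => by simp [hε]
  induction n generalizing f with
  | zero => exact key f
  | succ n ih => exact ⟨key f, ih _⟩

theorem TendstoC.add {n : ℕ} {F G : ι → ℝ → ℝ} {f g : ℝ → ℝ}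
    (hF : ∀ i, ContDiff ℝ ∞ (F i)) (hG : ∀ i, ContDiff ℝ ∞ (G i))
    (hf : ContDiff ℝ ∞ f) (hg : ContDiff ℝ ∞ g)
    (h : TendstoC l n F f) (h' : TendstoC l n G g) :
    TendstoC l n (fun i x => F i x + G i x) (fun x => f x + g x) := by
  induction n generalizing F G f g with
  | zero => exact TendstoUniformly.add h h'
  | succ n ih =>
    refine ⟨TendstoUniformly.add h.1 h'.1, ?_⟩
    have e : ∀ {u v : ℝ → ℝ}, ContDiff ℝ ∞ u → ContDiff ℝ ∞ v →
        deriv (fun x => u x + v x) = fun x => deriv u x + deriv v x := fun hu hv => by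
      funext x
      exact deriv_fun_add (hu.differentiable (by simp) x) (hv.differentiable (by simp) x)
    simp only [e (hF _) (hG _), e hf hg]
    exact ih (fun i => (contDiff_infty_iff_deriv.1 (hF i)).2)
      (fun i => (contDiff_infty_iff_deriv.1 (hG i)).2) (contDiff_infty_iff_deriv.1 hf).2
      (contDiff_infty_iff_deriv.1 hg).2 h.2 h'.2

theorem TendstoUniformly.mul_of_bounded {F G : ι → ℝ → ℝ} {f g : ℝ → ℝ} {M : ℝ}
    (hf : ∀ x, |f x| ≤ M) (hg : ∀ x, |g x| ≤ M)
    (h : TendstoUniformly F f l) (h' : TendstoUniformly G g l) :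
    TendstoUniformly (fun i x => F i x * G i x) (fun x => f x * g x) l := by
  rw [Metric.tendstoUniformly_iff] at h h' ⊢
  intro ε hε
  have hM : 0 ≤ M := (abs_nonneg _).trans (hf 0)
  set δ := min 1 (ε / (2 * M + 2)) with hδ
  have hδ0 : 0 < δ := lt_min one_pos (by positivity)
  filter_upwards [h δ hδ0, h' δ hδ0] with i hi hi' x
  have h1 := hi x
  have h2 := hi' x
  rw [Real.dist_eq] at h1 h2 ⊢
  have e : f x * g x - F i x * G i x
      = f x * (g x - G i x) + (f x - F i x) * g x - (f x - F i x) * (g x - G i x) := by ring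
  rw [e]
  have hδ1 : δ ≤ 1 := min_le_left _ _
  have hδ2 : δ * (2 * M + 2) ≤ ε := by
    have := min_le_right 1 (ε / (2 * M + 2))
    rwa [le_div_iff₀ (by positivity)] at this
  calc _ ≤ |f x| * |g x - G i x| + |f x - F i x| * |g x| + |f x - F i x| * |g x - G i x| := by
        rw [← abs_mul, ← abs_mul, ← abs_mul]
        exact (abs_sub _ _).trans (add_le_add (abs_add_le _ _) le_rfl)
    _ ≤ M * δ + δ * M + δ * 1 := by
        gcongr
        · exact hf x
        · exact hg x
        · exact h2.le.trans hδ1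
    _ < ε := by nlinarith

theorem Function.Periodic.exists_bound {f : ℝ → ℝ} (hp : Periodic f 1) (hf : Continuous f) :
    ∃ M, ∀ x, |f x| ≤ M := by
  obtain ⟨M, hM⟩ := (isCompact_Icc (a := (0 : ℝ)) (b := 1)).exists_bound_of_continuousOn
    hf.continuousOn
  refine ⟨M, fun x => ?_⟩
  have := hM (Int.fract x) ⟨Int.fract_nonneg x, (Int.fract_lt_one x).le⟩
  have e : f (Int.fract x) = f x := by
    rw [← Int.self_sub_floor]
    simpa using hp.sub_int_mul_eq (x := x) ⌊x⌋
  rwa [e] at this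

theorem deriv_add_one_eq {f : ℝ → ℝ} {d : ℝ} (h : ∀ x, f (x + 1) = f x + d) :
    Periodic (deriv f) 1 := by
  intro x
  rw [← deriv_comp_add_const f 1 x, funext h]
  simp

theorem Function.Periodic.deriv {f : ℝ → ℝ} (h : Periodic f 1) : Periodic (deriv f) 1 :=
  deriv_add_one_eq (d := 0) (by simpa using h)

theorem TendstoC.mul {n : ℕ} {F G : ι → ℝ → ℝ} {f g : ℝ → ℝ}
    (hF : ∀ i, ContDiff ℝ ∞ (F i)) (hG : ∀ i, ContDiff ℝ ∞ (G i))
    (hf : ContDiff ℝ ∞ f) (hg : ContDiff ℝ ∞ g) (pf : Periodic f 1) (pg : Periodic g 1)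
    (h : TendstoC l n F f) (h' : TendstoC l n G g) :
    TendstoC l n (fun i x => F i x * G i x) (fun x => f x * g x) := by
  have key : ∀ {F G : ι → ℝ → ℝ} {f g : ℝ → ℝ}, ContDiff ℝ ∞ f → ContDiff ℝ ∞ g →
      Periodic f 1 → Periodic g 1 → TendstoUniformly F f l → TendstoUniformly G g l →
      TendstoUniformly (fun i x => F i x * G i x) (fun x => f x * g x) l := by
    intro F G f g hf hg pf pg h h'
    obtain ⟨M, hM⟩ := pf.exists_bound hf.continuous
    obtain ⟨N, hN⟩ := pg.exists_bound hg.continuous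
    exact TendstoUniformly.mul_of_bounded (fun x => (hM x).trans (le_max_left M N))
      (fun x => (hN x).trans (le_max_right M N)) h h'
  induction n generalizing F G f g with
  | zero => exact key hf hg pf pg h h'
  | succ n ih =>
    refine ⟨key hf hg pf pg h.1 h'.1, ?_⟩
    have e : ∀ {u v : ℝ → ℝ}, ContDiff ℝ ∞ u → ContDiff ℝ ∞ v →
        deriv (fun x => u x * v x) = fun x => deriv u x * v x + u x * deriv v x :=
      fun hu hv => by
      funext x
      exact deriv_fun_mul (hu.differentiable (by simp) x) (hv.differentiable (by simp) x)
    have hF' := fun i => (contDiff_infty_iff_deriv.1 (hF i)).2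
    have hG' := fun i => (contDiff_infty_iff_deriv.1 (hG i)).2
    have hf' := (contDiff_infty_iff_deriv.1 hf).2
    have hg' := (contDiff_infty_iff_deriv.1 hg).2
    simp only [e (hF _) (hG _), e hf hg]
    exact TendstoC.add (fun i => (hF' i).mul (hG i)) (fun i => (hF i).mul (hG' i))
      (hf'.mul hg) (hf.mul hg') (ih hF' hG hf' hg pf.deriv pg h.2 h'.of_succ)
      (ih hF hG' hf hg' pf pg.deriv h.of_succ h'.2)

theorem uniformContinuous_of_add_one {f : ℝ → ℝ} {d : ℝ} (hf : ContDiff ℝ ∞ f)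
    (h : ∀ x, f (x + 1) = f x + d) : UniformContinuous f := by
  obtain ⟨M, hM⟩ := (deriv_add_one_eq h).exists_bound
    (contDiff_infty_iff_deriv.1 hf).2.continuous
  have : LipschitzWith M.toNNReal f :=
    lipschitzWith_of_nnnorm_deriv_le (hf.differentiable (by simp)) fun x => by
      rw [← NNReal.coe_le_coe, coe_nnnorm, Real.norm_eq_abs]
      exact (hM x).trans (Real.le_coe_toNNReal M)
  exact this.uniformContinuous

theorem TendstoUniformly.comp_real {F G : ι → ℝ → ℝ} {f g : ℝ → ℝ} (hf : UniformContinuous f)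
    (h : TendstoUniformly F f l) (h' : TendstoUniformly G g l) :
    TendstoUniformly (fun i x => F i (G i x)) (fun x => f (g x)) l := by
  rw [Metric.tendstoUniformly_iff] at h h' ⊢
  intro ε hε
  obtain ⟨δ, hδ, H⟩ := Metric.uniformContinuous_iff.1 hf (ε / 2) (half_pos hε)
  filter_upwards [h _ (half_pos hε), h' δ hδ] with i hi hi' x
  calc _ ≤ dist (f (g x)) (f (G i x)) + dist (f (G i x)) (F i (G i x)) := dist_triangle _ _ _
    _ < ε / 2 + ε / 2 := add_lt_add (H (hi' x)) (hi _)
    _ = ε := add_halves ε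

theorem Function.Periodic.comp_of_add_int {f g : ℝ → ℝ} {e : ℤ} (pf : Periodic f 1)
    (pg : ∀ x, g (x + 1) = g x + e) : Periodic (fun x => f (g x)) 1 := fun x => by
  have := pf.int_mul e (g x)
  simpa [pg x] using this

/-- By the chain rule the derivative is a product whose first factor is again a composition, so
induction on n works. Both maps commute with the unit translation up to constants, which makes f
uniformly continuous and both derivatives periodic, hence bounded. -/
theorem TendstoC.comp {n : ℕ} {F G : ι → ℝ → ℝ} {f g : ℝ → ℝ} {d : ℝ} {e : ℤ}
    (hF : ∀ i, ContDiff ℝ ∞ (F i)) (hG : ∀ i, ContDiff ℝ ∞ (G i))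
    (hf : ContDiff ℝ ∞ f) (hg : ContDiff ℝ ∞ g)
    (pf : ∀ x, f (x + 1) = f x + d) (pg : ∀ x, g (x + 1) = g x + e)
    (h : TendstoC l n F f) (h' : TendstoC l n G g) :
    TendstoC l n (fun i x => F i (G i x)) (fun x => f (g x)) := by
  induction n generalizing F f d with
  | zero => exact TendstoUniformly.comp_real (uniformContinuous_of_add_one hf pf) h h'
  | succ n ih =>
    refine ⟨TendstoUniformly.comp_real (uniformContinuous_of_add_one hf pf) h.1 h'.1, ?_⟩
    have key : ∀ {u v : ℝ → ℝ}, ContDiff ℝ ∞ u → ContDiff ℝ ∞ v →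
        deriv (fun x => u (v x)) = fun x => deriv u (v x) * deriv v x :=
      fun {u v} hu hv => by
      funext x
      exact deriv_comp x (hu.differentiable (by simp) (v x)) (hv.differentiable (by simp) x)
    have hF' := fun i => (contDiff_infty_iff_deriv.1 (hF i)).2
    have hG' := fun i => (contDiff_infty_iff_deriv.1 (hG i)).2
    have hf' := (contDiff_infty_iff_deriv.1 hf).2
    have hg' := (contDiff_infty_iff_deriv.1 hg).2
    simp only [key (hF _) (hG _), key hf hg]
    have pf' := deriv_add_one_eq pf
    exact TendstoC.mul (fun i => (hF' i).comp (hG i)) hG' (hf'.comp hg) hg'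
      (pf'.comp_of_add_int pg) (deriv_add_one_eq pg)
      (ih (d := 0) hF' hf' (by simpa using pf') h.2 h'.of_succ) h'.2

/-- Induction rests on V' = -P' V², which expresses the derivative through V itself and needs no
quotient rule beyond the first order. -/
theorem TendstoC.inv {n : ℕ} {P V : ι → ℝ → ℝ}
    (hP : ∀ i, ContDiff ℝ ∞ (P i)) (hV : ∀ i, ContDiff ℝ ∞ (V i))
    (hPV : ∀ i x, V i x * (1 + P i x) = 1) (h : TendstoC l n P (fun _ => 0)) :
    TendstoC l n V (fun _ => 1) := by
  have key : TendstoUniformly V (fun _ => 1) l := by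
    have h0 := h.tendstoUniformly
    rw [Metric.tendstoUniformly_iff] at h0 ⊢
    intro ε hε
    filter_upwards [h0 (min (1 / 2) (ε / 2)) (by positivity)] with i hi x
    have h1 := hi x
    rw [Real.dist_eq, lt_min_iff, abs_lt, abs_lt] at h1
    have h2 := hPV i x
    obtain ⟨⟨h3, h4⟩, h5, h6⟩ := h1
    have hv : V i x = 1 / (1 + P i x) := eq_one_div_of_mul_eq_one_left h2
    have hv2 : V i x ≤ 2 := by
      rw [hv, div_le_iff₀] <;> linarith
    have hv0 : 0 < V i x := by rw [hv]; apply one_div_pos.2; linarith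
    have e : (1 : ℝ) - V i x = V i x * P i x := by linarith
    rw [Real.dist_eq, e, abs_lt]
    constructor <;> nlinarith
  induction n with
  | zero => exact key
  | succ n ih =>
    refine ⟨key, ?_⟩
    have hV1 := ih h.of_succ
    have hP' := fun i => (contDiff_infty_iff_deriv.1 (hP i)).2
    have e : ∀ i, deriv (V i) = fun x => ((-1) * deriv (P i) x) * (V i x * V i x) := by
      intro i
      funext x
      have hne : ∀ x, 1 + P i x ≠ 0 := fun x h0 => by
        have := hPV i x
        simp [h0] at this
      have hv : V i = fun x => (1 + P i x)⁻¹ :=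
        funext fun x => eq_inv_of_mul_eq_one_left (hPV i x)
      have hd := (((hP i).differentiable (by simp) x).hasDerivAt.const_add 1).inv (hne x)
      have hd' : deriv (V i) x = -deriv (P i) x / (1 + P i x) ^ 2 := by
        rw [hv]; exact hd.deriv
      rw [hd', hv]
      field_simp
    have h0 : TendstoC l n (fun i => deriv (P i)) (fun _ => 0) := by
      have := h.2
      rwa [deriv_const'] at this
    simp only [e, deriv_const']
    have p0 : ∀ c : ℝ, Periodic (fun _ : ℝ => c) 1 := fun c x => rfl
    have h1 := TendstoC.mul (fun _ => contDiff_const) hP' contDiff_const contDiff_const (p0 _)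
      (p0 _) (TendstoC.const n fun _ => (-1 : ℝ)) h0
    have h2 := TendstoC.mul hV hV contDiff_const contDiff_const (p0 _) (p0 _) hV1 hV1
    simpa using TendstoC.mul (fun i => contDiff_const.mul (hP' i)) (fun i => (hV i).mul (hV i))
      contDiff_const contDiff_const (p0 _) (p0 _) h1 h2

/-- Each derivative exchanges sine and cosine and costs a factor 2πq; decay against every power of q
is therefore the hypothesis that reproduces itself. -/
theorem tendstoC_trig {A B C q : ι → ℝ} (hA : Tendsto A l (𝓝 0))
    (hB : ∀ k : ℕ, Tendsto (fun i => B i * q i ^ k) l (𝓝 0))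
    (hC : ∀ k : ℕ, Tendsto (fun i => C i * q i ^ k) l (𝓝 0)) (n : ℕ) :
    TendstoC l n (fun i x => A i + B i * Real.cos (2 * Real.pi * (q i * x))
      + C i * Real.sin (2 * Real.pi * (q i * x))) (fun _ => 0) := by
  have key : ∀ {A B C : ι → ℝ}, Tendsto A l (𝓝 0) →
      (∀ k : ℕ, Tendsto (fun i => B i * q i ^ k) l (𝓝 0)) →
      (∀ k : ℕ, Tendsto (fun i => C i * q i ^ k) l (𝓝 0)) →
      TendstoUniformly (fun i x => A i + B i * Real.cos (2 * Real.pi * (q i * x))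
        + C i * Real.sin (2 * Real.pi * (q i * x))) (fun _ => 0) l := by
    intro A B C hA hB hC
    have h1 : Tendsto (fun i => |A i| + |B i| + |C i|) l (𝓝 0) := by
      have hB0 := (hB 0).abs
      have hC0 := (hC 0).abs
      simpa using (hA.abs.add (by simpa using hB0)).add hC0
    rw [Metric.tendstoUniformly_iff]
    intro ε hε
    filter_upwards [h1.eventually (gt_mem_nhds hε)] with i hi x
    rw [dist_comm, Real.dist_eq, sub_zero]
    refine lt_of_le_of_lt ?_ hi
    refine (abs_add_le _ _).trans (add_le_add ((abs_add_le _ _).trans (add_le_add le_rfl ?_)) ?_)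
    · rw [abs_mul]
      exact mul_le_of_le_one_right (abs_nonneg _) (Real.abs_cos_le_one _)
    · rw [abs_mul]
      exact mul_le_of_le_one_right (abs_nonneg _) (Real.abs_sin_le_one _)
  induction n generalizing A B C with
  | zero => exact key hA hB hC
  | succ n ih =>
    refine ⟨key hA hB hC, ?_⟩
    have e : ∀ i, deriv (fun x => A i + B i * Real.cos (2 * Real.pi * (q i * x))
        + C i * Real.sin (2 * Real.pi * (q i * x))) = fun x => 0
        + (2 * Real.pi * (C i * q i)) * Real.cos (2 * Real.pi * (q i * x))
        + (-(2 * Real.pi) * (B i * q i)) * Real.sin (2 * Real.pi * (q i * x)) := by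
      intro i
      funext x
      have h0 : HasDerivAt (fun x : ℝ => 2 * Real.pi * (q i * x)) (2 * Real.pi * (q i * 1)) x :=
        ((hasDerivAt_id x).const_mul _).const_mul _
      have := ((h0.cos.const_mul (B i)).const_add (A i)).add (h0.sin.const_mul (C i))
      refine (HasDerivAt.deriv this).trans ?_
      ring
    simp only [e, deriv_const']
    refine ih tendsto_const_nhds (fun k => ?_) fun k => ?_
    · have := (hC (k + 1)).const_mul (2 * Real.pi)
      simp only [mul_zero] at this
      exact this.congr fun i => by ring
    · have := (hB (k + 1)).const_mul (-(2 * Real.pi))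
      simp only [mul_zero] at this
      exact this.congr fun i => by ring

end UniformSmoothConvergence

/-! ### Möbius maps of the circle and their lifts through x ↦ qx -/

section Mobius

open Real

/-- The lift fixing `0` of the action of the Blaschke factor `z ↦ (z + r) / (1 + r z)` on the
unit circle. -/
noncomputable def mobiusLift (r x : ℝ) : ℝ :=
  x - arctan (r * sin (2 * π * x) / (1 + r * cos (2 * π * x))) / π

variable {r : ℝ}

theorem one_add_mul_cos_pos (hr : |r| < 1) (y : ℝ) : 0 < 1 + r * cos y := by
  have h : |r * cos y| < 1 := by
    rw [abs_mul]
    exact (mul_le_of_le_one_right (abs_nonneg _) (abs_cos_le_one y)).trans_lt hr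
  linarith [(abs_lt.1 h).1]

theorem one_sub_sq_pos (hr : |r| < 1) : 0 < 1 - r ^ 2 := by
  have := (sq_lt_one_iff_abs_lt_one r).2 hr
  linarith

theorem poisson_den_pos (hr : |r| < 1) (y : ℝ) : 0 < 1 + r ^ 2 + 2 * r * cos y := by
  have h1 := one_add_mul_cos_pos hr y
  nlinarith [sin_sq_add_cos_sq y, sq_nonneg (r * sin y), sq_nonneg (1 + r * cos y)]

theorem poisson_den_eq (r y : ℝ) :
    (1 + r * cos y) ^ 2 + (r * sin y) ^ 2 = 1 + r ^ 2 + 2 * r * cos y := by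
  linear_combination r ^ 2 * sin_sq_add_cos_sq y

theorem contDiff_mobiusLift (hr : |r| < 1) : ContDiff ℝ ∞ (mobiusLift r) := by
  unfold mobiusLift
  refine contDiff_id.sub (ContDiff.div_const (contDiff_arctan.comp (ContDiff.div ?_ ?_ ?_)) _)
  · fun_prop
  · fun_prop
  · exact fun x => (one_add_mul_cos_pos hr _).ne'

theorem mobiusLift_add_int (r x : ℝ) (n : ℤ) : mobiusLift r (x + n) = mobiusLift r x + n := by
  have e : 2 * π * (x + n) = 2 * π * x + n * (2 * π) := by ring
  rw [mobiusLift, mobiusLift, e, sin_add_int_mul_two_pi, cos_add_int_mul_two_pi]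
  ring

theorem abs_mobiusLift_sub_le (r x : ℝ) : |mobiusLift r x - x| ≤ 1 / 2 := by
  have h1 := neg_pi_div_two_lt_arctan (r * sin (2 * π * x) / (1 + r * cos (2 * π * x)))
  have h2 := arctan_lt_pi_div_two (r * sin (2 * π * x) / (1 + r * cos (2 * π * x)))
  have e : mobiusLift r x - x
    = -(arctan (r * sin (2 * π * x) / (1 + r * cos (2 * π * x))) / π) := by
    rw [mobiusLift]; ring
  rw [e, abs_neg, abs_le, le_div_iff₀ pi_pos, div_le_iff₀ pi_pos]
  constructor <;> linarith

theorem hasDerivAt_mobiusLift (hr : |r| < 1) (x : ℝ) :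
    HasDerivAt (mobiusLift r) ((1 - r ^ 2) / (1 + r ^ 2 + 2 * r * cos (2 * π * x))) x := by
  have h0 : HasDerivAt (fun x : ℝ => 2 * π * x) (2 * π) x := by
    simpa using (hasDerivAt_id x).const_mul (2 * π)
  have hd := one_add_mul_cos_pos hr (2 * π * x)
  have hp := poisson_den_pos hr (2 * π * x)
  have h1 := (((h0.sin.const_mul r).div ((h0.cos.const_mul r).const_add 1) hd.ne').arctan.div_const
    π)
  have h2 := (hasDerivAt_id x).sub h1
  refine h2.congr_deriv ?_
  have hπ := pi_ne_zero
  have hq := poisson_den_eq r (2 * π * x)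
  have hsc := sin_sq_add_cos_sq (2 * π * x)
  simp only [Pi.div_apply]
  set c := cos (2 * π * x)
  set s := sin (2 * π * x)
  have e : 1 + (r * s / (1 + r * c)) ^ 2 = (1 + r ^ 2 + 2 * r * c) / (1 + r * c) ^ 2 := by
    rw [← hq]
    field_simp
  rw [e]
  generalize hD : 1 + r ^ 2 + 2 * r * c = D at *
  field_simp
  rw [← hD]
  linear_combination (-2 * r ^ 2) * hsc

/-- These are the real and imaginary parts of the Blaschke factor at exp(2πix): the arctangent is
the argument of 1 + r exp(2πix), and subtracting it twice divides by that number and multiplies by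
its conjugate. -/
theorem cos_mobiusLift (hr : |r| < 1) (x : ℝ) : cos (2 * π * mobiusLift r x) =
    ((1 + r ^ 2) * cos (2 * π * x) + 2 * r) / (1 + r ^ 2 + 2 * r * cos (2 * π * x)) ∧
    sin (2 * π * mobiusLift r x) =
    (1 - r ^ 2) * sin (2 * π * x) / (1 + r ^ 2 + 2 * r * cos (2 * π * x)) := by
  have hd := one_add_mul_cos_pos hr (2 * π * x)
  have hp := poisson_den_pos hr (2 * π * x)
  have hq := poisson_den_eq r (2 * π * x)
  have hsc := sin_sq_add_cos_sq (2 * π * x)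
  have e : 2 * π * mobiusLift r x = 2 * π * x
      - 2 * arctan (r * sin (2 * π * x) / (1 + r * cos (2 * π * x))) := by
    have hπ := pi_ne_zero
    rw [mobiusLift]
    field_simp
  rw [e, cos_sub, sin_sub, cos_two_mul (arctan _), sin_two_mul (arctan _), mul_assoc 2 (sin _),
    mul_comm (sin (arctan _))]
  set c := cos (2 * π * x)
  set s := sin (2 * π * x)
  set u := r * s / (1 + r * c) with hu
  have hu2 : 1 + u ^ 2 = (1 + r ^ 2 + 2 * r * c) / (1 + r * c) ^ 2 := by
    rw [← hq, hu]
    field_simp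
  have hc2 : cos (arctan u) ^ 2 = (1 + r * c) ^ 2 / (1 + r ^ 2 + 2 * r * c) := by
    rw [cos_sq_arctan, hu2, one_div_div]
  have hcs : cos (arctan u) * sin (arctan u) = u * cos (arctan u) ^ 2 := by
    have h1 := (cos_arctan_pos u).ne'
    have h2 := tan_arctan u
    rw [tan_eq_sin_div_cos, div_eq_iff h1] at h2
    rw [h2]
    ring
  rw [hcs, hc2, hu]
  generalize hD : 1 + r ^ 2 + 2 * r * c = D at *
  constructor
  · field_simp
    linear_combination (2 * r + 2 * r ^ 2 * c) * hsc + c * hD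
  · field_simp
    linear_combination s * hD

theorem mobiusLift_neg_apply (hr : |r| < 1) (x : ℝ) : mobiusLift (-r) (mobiusLift r x) = x := by
  obtain ⟨h1, h2⟩ := cos_mobiusLift hr x
  have hd := one_add_mul_cos_pos hr (2 * π * x)
  have hp := poisson_den_pos hr (2 * π * x)
  have hr2 := one_sub_sq_pos hr
  have e : -r * sin (2 * π * mobiusLift r x) / (1 + -r * cos (2 * π * mobiusLift r x)) =
      -(r * sin (2 * π * x) / (1 + r * cos (2 * π * x))) := by
    have e1 : 1 + -r * cos (2 * π * mobiusLift r x)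
      = (1 - r ^ 2) * (1 + r * cos (2 * π * x)) / (1 + r ^ 2 + 2 * r * cos (2 * π * x)) := by
      rw [h1]
      generalize hD : 1 + r ^ 2 + 2 * r * cos (2 * π * x) = D at *
      field_simp
      rw [← hD]
      ring
    rw [e1, h2]
    generalize 1 + r ^ 2 + 2 * r * cos (2 * π * x) = D at *
    field_simp
  rw [mobiusLift, e, arctan_neg, mobiusLift]
  ring

theorem mobiusLift_apply_neg (hr : |r| < 1) (x : ℝ) : mobiusLift r (mobiusLift (-r) x) = x := by
  have := mobiusLift_neg_apply (r := -r) (by rwa [abs_neg]) x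
  rwa [neg_neg] at this

theorem mobiusLift_monotone (hr : |r| < 1) : Monotone (mobiusLift r) :=
  monotone_of_hasDerivAt_nonneg (hasDerivAt_mobiusLift hr) fun _ =>
    (div_pos (one_sub_sq_pos hr) (poisson_den_pos hr _)).le

/-- The lift of the circle homeomorphism covered by `mobiusLift r` under `x ↦ q x`. -/
noncomputable def mobiusRoot (hr : |r| < 1) {q : ℕ} (hq : 0 < q) : CircleDeg1Lift where
  toFun x := mobiusLift r (q * x) / q
  monotone' x y h := by
    have := mobiusLift_monotone hr (mul_le_mul_of_nonneg_left h q.cast_nonneg)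
    exact div_le_div_of_nonneg_right this q.cast_nonneg
  map_add_one' x := by
    have hq' : (q : ℝ) ≠ 0 := by positivity
    have := mobiusLift_add_int r (q * x) q
    rw [Int.cast_natCast] at this
    rw [mul_add, mul_one, this, add_div, div_self hq']

theorem mobiusRoot_apply (hr : |r| < 1) {q : ℕ} (hq : 0 < q) (x : ℝ) :
    mobiusRoot hr hq x = mobiusLift r (q * x) / q := rfl

theorem contDiff_mobiusRoot (hr : |r| < 1) {q : ℕ} (hq : 0 < q) :
    ContDiff ℝ ∞ (mobiusRoot hr hq) :=
  ContDiff.div_const ((contDiff_mobiusLift hr).comp (contDiff_const.mul contDiff_id)) _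

theorem abs_mobiusRoot_sub_le (hr : |r| < 1) {q : ℕ} (hq : 0 < q) (x : ℝ) :
    |mobiusRoot hr hq x - x| ≤ 1 / (2 * q) := by
  have hq' : (0 : ℝ) < q := by positivity
  have e : mobiusRoot hr hq x - x = (mobiusLift r (q * x) - q * x) / q := by
    rw [mobiusRoot_apply]
    field_simp
  rw [e, abs_div, abs_of_pos hq', div_le_iff₀ hq']
  refine (abs_mobiusLift_sub_le _ _).trans_eq ?_
  field_simp

/-- `mobiusRoot` as an invertible lift. -/
noncomputable def mobiusUnit (hr : |r| < 1) {q : ℕ} (hq : 0 < q) : CircleDeg1Liftˣ where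
  val := mobiusRoot hr hq
  inv := mobiusRoot (r := -r) (by rwa [abs_neg]) hq
  val_inv := CircleDeg1Lift.ext fun x => by
    have hq' : (q : ℝ) ≠ 0 := by positivity
    rw [CircleDeg1Lift.mul_apply, mobiusRoot_apply, mobiusRoot_apply, mul_div_cancel₀ _ hq',
      mobiusLift_apply_neg hr, mul_div_cancel_left₀ _ hq']
    rfl
  inv_val := CircleDeg1Lift.ext fun x => by
    have hq' : (q : ℝ) ≠ 0 := by positivity
    rw [CircleDeg1Lift.mul_apply, mobiusRoot_apply, mobiusRoot_apply, mul_div_cancel₀ _ hq',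
      mobiusLift_neg_apply hr, mul_div_cancel_left₀ _ hq']
    rfl

theorem mobiusUnit_apply (hr : |r| < 1) {q : ℕ} (hq : 0 < q) (x : ℝ) :
    mobiusUnit hr hq x = mobiusRoot hr hq x := rfl

theorem mobiusUnit_inv_apply (hr : |r| < 1) {q : ℕ} (hq : 0 < q) (x : ℝ) :
    (mobiusUnit hr hq)⁻¹ x = mobiusRoot (r := -r) (by rwa [abs_neg]) hq x := rfl

/-- Multiplication by q sends the two points to ±1/4, that is, to ±i, which the Möbius map pulls
towards its attracting fixed point 1: their images are ±(1/4 - arctan r / π). The bound follows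
because arctan is 1-Lipschitz and arctan 1 = π/4. -/
theorem mobiusUnit_contraction (hr : |r| < 1) {q : ℕ} (hq : 0 < q) :
    |mobiusUnit hr hq (1 / (4 * q)) - mobiusUnit hr hq (-(1 / (4 * q)))| ≤ 1 - r := by
  have hq' : (0 : ℝ) < q := by positivity
  have e1 : (q : ℝ) * (1 / (4 * q)) = 1 / 4 := by field_simp
  have e2 : (q : ℝ) * -(1 / (4 * q)) = -(1 / 4) := by field_simp
  have e3 : 2 * π * (1 / 4) = π / 2 := by ring
  have e4 : 2 * π * -(1 / 4) = -(π / 2) := by ring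
  have hr1 : r ≤ 1 := (le_abs_self r).trans hr.le
  rw [mobiusUnit_apply, mobiusUnit_apply, mobiusRoot_apply, mobiusRoot_apply, e1, e2, mobiusLift,
    mobiusLift, e3, e4, sin_neg, cos_neg, sin_pi_div_two, cos_pi_div_two]
  have e5 : r * -1 / (1 + r * 0) = -r := by ring
  have e6 : r * 1 / (1 + r * 0) = r := by ring
  rw [e5, e6, arctan_neg]
  have h1 : arctan 1 - arctan r ≤ 1 - r := by
    have hmono : Monotone fun x => x - arctan x :=
      monotone_of_hasDerivAt_nonneg (fun x => (hasDerivAt_id x).sub (hasDerivAt_arctan x))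
        fun x => by
          refine sub_nonneg.2 ?_
          rw [div_le_one (by positivity)]
          nlinarith [sq_nonneg x]
    have := hmono hr1
    simp only at this
    linarith
  have h2 : arctan r ≤ arctan 1 := arctan_mono hr1
  rw [arctan_one] at h1 h2
  have e7 : (1 / 4 - arctan r / π) / q - (-(1 / 4) - -arctan r / π) / q
      = (2 * (π / 4 - arctan r)) / (π * q) := by
    field_simp
    ring
  have hπ := pi_gt_three
  have hq1 : (1 : ℝ) ≤ q := by exact_mod_cast hq
  rw [e7, abs_of_nonneg (div_nonneg (by linarith) (by positivity)), div_le_iff₀ (by positivity)]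
  nlinarith [mul_nonneg (sub_nonneg.2 hr1) (by nlinarith : (0 : ℝ) ≤ π * q - 2)]

/-- The derivative of the rotation by `τ` conjugated by a Möbius map is the reciprocal of a
trigonometric polynomial. -/
theorem mobius_conj_deriv (hr : |r| < 1) (τ x : ℝ) :
    HasDerivAt (fun x => mobiusLift r (mobiusLift (-r) x + τ))
      ((1 + (-4 * r ^ 2 * (cos (2 * π * τ) - 1) / (1 - r ^ 2) ^ 2
        + 2 * r * (1 + r ^ 2) * (cos (2 * π * τ) - 1) / (1 - r ^ 2) ^ 2 * cos (2 * π * x)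
        + -2 * r * (1 - r ^ 2) * sin (2 * π * τ) / (1 - r ^ 2) ^ 2 * sin (2 * π * x)))⁻¹) x := by
  have hr' : |-r| < 1 := by rwa [abs_neg]
  have h1 := (hasDerivAt_mobiusLift hr (mobiusLift (-r) x + τ)).comp x
    ((hasDerivAt_mobiusLift hr' x).add_const τ)
  refine h1.congr_deriv ?_
  obtain ⟨hc, hs⟩ := cos_mobiusLift hr' x
  have hp := poisson_den_pos hr' (2 * π * x)
  have hp' := poisson_den_pos hr (2 * π * (mobiusLift (-r) x + τ))
  have hr2 := one_sub_sq_pos hr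
  rw [mul_add, cos_add, hc, hs] at hp' ⊢
  simp only [neg_sq] at hp hp' ⊢
  set c := cos (2 * π * x)
  set s := sin (2 * π * x)
  refine eq_inv_of_mul_eq_one_left ?_
  generalize hD : 1 + r ^ 2 + 2 * -r * c = D at *
  -- The denominator of the outer Poisson kernel, written over D. The D cancels against the inner
  -- kernel and (1 - r²)² against the two numerators, leaving the reciprocal of a trigonometric
  -- polynomial.
  have hE : (1 + r ^ 2 + 2 * r * (((1 + r ^ 2) * c + 2 * -r) / (D)
      * cos (2 * π * τ) - (1 - r ^ 2) * s / (D) * sin (2 * π * τ)))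
      = ((1 - r ^ 2) ^ 2 * (1 + (-4 * r ^ 2 * (cos (2 * π * τ) - 1) / (1 - r ^ 2) ^ 2
        + 2 * r * (1 + r ^ 2) * (cos (2 * π * τ) - 1) / (1 - r ^ 2) ^ 2 * c
        + -2 * r * (1 - r ^ 2) * sin (2 * π * τ) / (1 - r ^ 2) ^ 2 * s)))
        / (D) := by
    field_simp
    rw [← hD]
    ring
  rw [hE] at hp' ⊢
  set W := 1 + (-4 * r ^ 2 * (cos (2 * π * τ) - 1) / (1 - r ^ 2) ^ 2
        + 2 * r * (1 + r ^ 2) * (cos (2 * π * τ) - 1) / (1 - r ^ 2) ^ 2 * c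
        + -2 * r * (1 - r ^ 2) * sin (2 * π * τ) / (1 - r ^ 2) ^ 2 * s)
  have hW : W ≠ 0 := by
    rintro h
    simp [h] at hp'
  field_simp

end Mobius

/-! ### One step of the construction: strong contraction, small change of the conjugate -/

section Stage

open Real

theorem abs_cos_sub_one_le (y : ℝ) : |cos y - 1| ≤ |y| := by
  simpa using abs_cos_sub_cos_le y 0

/-- The group of lifts of orientation-preserving smooth circle diffeomorphisms. -/
def smoothUnits : Subgroup CircleDeg1Liftˣ where
  carrier := {u | ContDiff ℝ ∞ u ∧ ContDiff ℝ ∞ (u⁻¹ : CircleDeg1Liftˣ)}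
  mul_mem' := fun {a b} ha hb => ⟨ha.1.comp hb.1, by
    rw [mul_inv_rev]
    exact hb.2.comp ha.2⟩
  one_mem' := ⟨contDiff_id, by
    rw [inv_one]
    exact contDiff_id⟩
  inv_mem' := fun h => ⟨h.2, by
    rw [inv_inv]
    exact h.1⟩

/-- The lift `x ↦ β + x` of a rotation. -/
noncomputable abbrev rot (β : ℝ) : CircleDeg1Liftˣ :=
  CircleDeg1Lift.translate (Multiplicative.ofAdd β)

theorem rot_mem_smoothUnits (β : ℝ) : rot β ∈ smoothUnits := by
  constructor
  · have : ((rot β : CircleDeg1Liftˣ) : ℝ → ℝ) = fun x => β + x :=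
      funext fun x => CircleDeg1Lift.translate_apply β x
    rw [this]
    fun_prop
  · have : ((rot β)⁻¹ : CircleDeg1Liftˣ) = (fun x => -β + x : ℝ → ℝ) :=
      funext fun x => CircleDeg1Lift.translate_inv_apply β x
    rw [this]
    fun_prop

theorem mobiusUnit_mem_smoothUnits {r : ℝ} (hr : |r| < 1) {q : ℕ} (hq : 0 < q) :
    mobiusUnit hr hq ∈ smoothUnits :=
  ⟨contDiff_mobiusRoot hr hq, contDiff_mobiusRoot (r := -r) (by rwa [abs_neg]) hq⟩

/-- The conjugate by `H` of the rotation by `β`. -/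
noncomputable def conjRot (H : CircleDeg1Liftˣ) (β : ℝ) : CircleDeg1Liftˣ := H * rot β * H⁻¹

theorem conjRot_apply (H : CircleDeg1Liftˣ) (β x : ℝ) : conjRot H β x = H (β + H⁻¹ x) := by
  simp [conjRot, CircleDeg1Lift.mul_apply]

theorem conjRot_mem_smoothUnits {H : CircleDeg1Liftˣ} (hH : H ∈ smoothUnits) (β : ℝ) :
    conjRot H β ∈ smoothUnits :=
  mul_mem (mul_mem hH (rot_mem_smoothUnits β)) (inv_mem hH)

theorem conjRot_mul_apply (H f : CircleDeg1Liftˣ) (β x : ℝ) :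
    conjRot (H * f) β x = H (conjRot f β (H⁻¹ x)) := by
  simp [conjRot, CircleDeg1Lift.mul_apply, mul_inv_rev]

/-- In the q-fold cover the rotation angle is qβ, which matters only modulo integers, hence the
quantity |qβ - p|. Order zero is free, since the Möbius lift is within 1/(2q) of the identity; the
derivative is the reciprocal of 1 plus a trigonometric polynomial with coefficients O(|qβ - p| / (1
- r²)²). -/
theorem tendstoC_conjRot_mobius {ι : Type*} {l : Filter ι} {r : ι → ℝ} (hr : ∀ i, |r i| < 1)
    {q : ι → ℕ} (hq : ∀ i, 0 < q i) {p : ι → ℤ} {β : ℝ} (hql : Tendsto q l atTop)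
    (h : ∀ k : ℕ, Tendsto (fun i => |q i * β - p i| / (1 - r i ^ 2) ^ 2 * (q i : ℝ) ^ k) l (𝓝 0))
    (n : ℕ) : TendstoC l n (fun i => conjRot (mobiusUnit (hr i) (hq i)) β) (fun x => β + x) := by
  have happ : ∀ i x, conjRot (mobiusUnit (hr i) (hq i)) β x
      = mobiusLift (r i) (mobiusLift (-r i) (q i * x) + q i * β) / q i := by
    intro i x
    have hq' : (q i : ℝ) ≠ 0 := by have := hq i; positivity
    rw [conjRot_apply, mobiusUnit_inv_apply, mobiusUnit_apply, mobiusRoot_apply, mobiusRoot_apply,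
      mul_add, mul_div_cancel₀ _ hq', add_comm]
  have h0 : TendstoUniformly (fun i => (conjRot (mobiusUnit (hr i) (hq i)) β : ℝ → ℝ))
      (fun x => β + x) l := by
    rw [Metric.tendstoUniformly_iff]
    intro ε hε
    have h1 : Tendsto (fun i => (1 : ℝ) / q i) l (𝓝 0) :=
      tendsto_const_nhds.div_atTop (tendsto_natCast_atTop_atTop.comp hql)
    filter_upwards [h1.eventually (gt_mem_nhds hε)] with i hi x
    rw [conjRot_apply, mobiusUnit_inv_apply, mobiusUnit_apply, dist_comm, Real.dist_eq]
    refine lt_of_le_of_lt ?_ hi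
    have hr' : |-r i| < 1 := by rw [abs_neg]; exact hr i
    have e1 := abs_mobiusRoot_sub_le hr' (hq i) x
    have e2 := abs_mobiusRoot_sub_le (hr i) (hq i) (β + mobiusRoot hr' (hq i) x)
    have e3 : (1 : ℝ) / q i = 1 / (2 * q i) + 1 / (2 * q i) := by
      have hq' : (q i : ℝ) ≠ 0 := by have := hq i; positivity
      field_simp
      norm_num
    rw [e3, ← sub_add_sub_cancel _ (β + mobiusRoot hr' (hq i) x)]
    refine (abs_add_le _ _).trans (add_le_add e2 ?_)
    rwa [add_sub_add_left_eq_sub]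
  cases n with
  | zero => exact h0
  | succ n =>
    refine ⟨h0, ?_⟩
    have hd1 : deriv (fun x : ℝ => β + x) = fun _ => 1 := by
      funext x
      simp
    rw [hd1]
    set A : ι → ℝ := fun i => -4 * r i ^ 2 * (cos (2 * π * (q i * β)) - 1) / (1 - r i ^ 2) ^ 2
    set B : ι → ℝ := fun i =>
      2 * r i * (1 + r i ^ 2) * (cos (2 * π * (q i * β)) - 1) / (1 - r i ^ 2) ^ 2
    set C : ι → ℝ := fun i =>
      -2 * r i * (1 - r i ^ 2) * sin (2 * π * (q i * β)) / (1 - r i ^ 2) ^ 2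
    have hder : ∀ i, deriv (conjRot (mobiusUnit (hr i) (hq i)) β) = fun x =>
        (1 + (A i + B i * cos (2 * π * (q i * x)) + C i * sin (2 * π * (q i * x))))⁻¹ := by
      intro i
      funext x
      have hq' : (q i : ℝ) ≠ 0 := by have := hq i; positivity
      have h1 := mobius_conj_deriv (hr i) (q i * β) (q i * x)
      have h2 := (h1.comp x ((hasDerivAt_id x).const_mul (q i : ℝ))).div_const (q i : ℝ)
      rw [funext (happ i)]
      refine h2.deriv.trans ?_
      rw [mul_one, mul_div_cancel_right₀ _ hq']
    -- At a zero the convention 0⁻¹ = 0 would make the derivative vanish, contradicting the chain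
    -- rule for the smooth inverse.
    have hpos : ∀ i x, (1 + (A i + B i * cos (2 * π * (q i * x))
        + C i * sin (2 * π * (q i * x)))) ≠ 0 := by
      intro i x hz
      have hs := conjRot_mem_smoothUnits (mobiusUnit_mem_smoothUnits (hr i) (hq i)) β
      have hd := congrFun (hder i) x
      rw [hz, inv_zero] at hd
      have e1 := ((hs.2.differentiable (by simp)
        (conjRot (mobiusUnit (hr i) (hq i)) β x)).hasDerivAt).comp x
        (hs.1.differentiable (by simp) x).hasDerivAt
      rw [hd, mul_zero] at e1
      have e2 : ((conjRot (mobiusUnit (hr i) (hq i)) β)⁻¹ : CircleDeg1Liftˣ) ∘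
          (conjRot (mobiusUnit (hr i) (hq i)) β) = (id : ℝ → ℝ) :=
        funext fun y => CircleDeg1Lift.units_inv_apply_apply _ y
      rw [e2] at e1
      exact zero_ne_one (e1.unique (hasDerivAt_id x))
    have hbound : ∀ i, |cos (2 * π * (q i * β)) - 1| ≤ 2 * π * |q i * β - p i| ∧
        |sin (2 * π * (q i * β))| ≤ 2 * π * |q i * β - p i| := by
      intro i
      have e : 2 * π * (q i * β) = 2 * π * (q i * β - p i) + p i * (2 * π) := by ring
      have e' : 2 * π * |q i * β - p i| = |2 * π * (q i * β - p i)| := by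
        rw [abs_mul, abs_of_pos two_pi_pos]
      rw [e, cos_add_int_mul_two_pi, sin_add_int_mul_two_pi, e']
      exact ⟨abs_cos_sub_one_le _, abs_sin_le_abs⟩
    have hlim : ∀ {D : ι → ℝ},
        (∀ i, |D i| ≤ 8 * π * (|q i * β - p i| / (1 - r i ^ 2) ^ 2)) →
        ∀ k : ℕ, Tendsto (fun i => D i * (q i : ℝ) ^ k) l (𝓝 0) := by
      intro D hD k
      have h1 := (h k).const_mul (8 * π)
      rw [mul_zero] at h1
      refine squeeze_zero_norm (fun i => ?_) h1
      rw [Real.norm_eq_abs, abs_mul, abs_of_nonneg (a := (q i : ℝ) ^ k) (by positivity), ← mul_assoc]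
      gcongr
      exact hD i
    have hcoef : ∀ {c y E s : ℝ}, |c| ≤ 4 → |y| ≤ 2 * π * E → 0 < s →
        |c * y / s| ≤ 8 * π * (E / s) := by
      intro c y E s hc hy hs
      rw [abs_div, abs_mul, abs_of_pos hs, ← mul_div_assoc]
      refine div_le_div_of_nonneg_right ?_ hs.le
      calc |c| * |y| ≤ 4 * (2 * π * E) := by gcongr
        _ = _ := by ring
    have hs : ∀ i, 0 < (1 - r i ^ 2) ^ 2 := fun i => pow_pos (one_sub_sq_pos (hr i)) 2
    have hA := hlim (D := A) fun i => hcoef (by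
      have := one_sub_sq_pos (hr i)
      rw [abs_le]; constructor <;> nlinarith [sq_nonneg (r i)]) (hbound i).1 (hs i)
    have hB := hlim (D := B) fun i => hcoef (by
      have h1 := one_sub_sq_pos (hr i)
      have h2 := (hr i).le
      rw [abs_mul, abs_mul, abs_of_pos (zero_lt_two' ℝ),
        abs_of_pos (a := 1 + r i ^ 2) (by positivity)]
      nlinarith [abs_nonneg (r i)]) (hbound i).1 (hs i)
    have hC := hlim (D := C) fun i => hcoef (by
      have h1 := one_sub_sq_pos (hr i)
      have h2 := (hr i).le
      rw [abs_mul, abs_mul, abs_of_pos h1, abs_neg, abs_of_pos (zero_lt_two' ℝ)]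
      nlinarith [abs_nonneg (r i), sq_nonneg (r i)]) (hbound i).2 (hs i)
    have hT := tendstoC_trig (q := fun i => (q i : ℝ)) (by simpa using hA 0) hB hC n
    simp only [hder]
    have hPs : ∀ i, ContDiff ℝ ∞ fun x : ℝ => A i + B i * cos (2 * π * (q i * x))
        + C i * sin (2 * π * (q i * x)) := fun i => by fun_prop
    exact hT.inv hPs (fun i => (contDiff_const.add (hPs i)).inv (hpos i))
      fun i x => inv_mul_cancel₀ (hpos i x)

theorem CircleDeg1Lift.units_exists_lipschitz {H : CircleDeg1Liftˣ} (hH : H ∈ smoothUnits) :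
    ∃ M, ∀ s t, |H s - H t| ≤ M * |s - t| := by
  have h1 : ∀ x, (H : ℝ → ℝ) (x + 1) = H x + 1 := fun x => CircleDeg1Lift.map_add_one _ x
  obtain ⟨M, hM⟩ := (deriv_add_one_eq h1).exists_bound
    (contDiff_infty_iff_deriv.1 hH.1).2.continuous
  refine ⟨M, fun s t => ?_⟩
  exact Convex.norm_image_sub_le_of_norm_deriv_le
    (fun x _ => hH.1.differentiable (by simp) x) (fun x _ => hM x) convex_univ (mem_univ t)
    (mem_univ s)

theorem tendstoC_conjRot_mul {ι : Type*} {l : Filter ι} {f : ι → CircleDeg1Liftˣ}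
    (hf : ∀ i, f i ∈ smoothUnits) {H : CircleDeg1Liftˣ} (hH : H ∈ smoothUnits) {β : ℝ} {n : ℕ}
    (h : TendstoC l n (fun i => conjRot (f i) β) (fun x => β + x)) :
    TendstoC l n (fun i => conjRot (H * f i) β) (conjRot H β) := by
  have p1 : ∀ (u : CircleDeg1Liftˣ) (x : ℝ), u (x + 1) = u x + ((1 : ℤ) : ℝ) := fun u x => by
    simp
  have hs := fun i => (conjRot_mem_smoothUnits (hf i) β).1
  have h1 := TendstoC.comp hs (fun _ => hH.2) (by fun_prop) hH.2 (d := 1)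
    (by intro x; ring) (p1 _) h (TendstoC.const n _)
  have h2 := TendstoC.comp (fun _ => hH.1) (fun i => (hs i).comp hH.2) hH.1
    (g := fun x => β + H⁻¹ x) (contDiff_const.add hH.2) (p1 H)
    (fun x => by rw [p1, add_assoc]) (TendstoC.const n _) h1
  have e1 : (fun i => (conjRot (H * f i) β : ℝ → ℝ)) = fun i x => H (conjRot (f i) β (H⁻¹ x)) :=
    funext fun i => funext fun x => conjRot_mul_apply H (f i) β x
  have e2 : (conjRot H β : ℝ → ℝ) = fun x => H (β + H⁻¹ x) := funext (conjRot_apply H β)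
  rw [e1, e2]
  exact h2

/-- For a Liouville number `α` and finitely many lifts of diffeomorphisms, there is a strongly
contracting `f` which hardly changes the conjugates of `R_α` and `R_{-α}` by them. -/
theorem Liouville.exists_contracting_perturbation {α : ℝ} (hα : Liouville α)
    {K : Set CircleDeg1Liftˣ} (hK : K.Finite) (hKs : ∀ H ∈ K, H ∈ smoothUnits) (n : ℕ)
    {ε : ℝ} (hε : 0 < ε) :
    ∃ f ∈ smoothUnits, ∃ q : ℕ, n + 2 ≤ q ∧
      |f (1 / (4 * q)) - f (-(1 / (4 * q)))| ≤ (1 / q) ^ n ∧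
      ∀ H ∈ K, (∀ t, |(H * f) t - H t| ≤ ε) ∧ (∀ s t, |H s - H t| ≤ q * |s - t|) ∧
        (∀ s t, |s - t| ≤ q * |H s - H t|) ∧
        ∀ k ≤ n, ∀ t,
          |iteratedDeriv k (conjRot (H * f) α) t - iteratedDeriv k (conjRot H α) t| ≤ ε ∧
          |iteratedDeriv k (conjRot (H * f) (-α)) t - iteratedDeriv k (conjRot H (-α)) t| ≤ ε := by
  -- Requiring q ≥ j + 2 forces the denominators to infinity, whereas the exponent j makes the
  -- approximation beat any fixed power of q.
  have hex : ∀ j : ℕ, ∃ (q : ℕ) (p : ℤ), j + 2 ≤ q ∧ |q * α - p| ≤ q * (1 / q) ^ j := by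
    intro j
    obtain ⟨q, ⟨p, -, hp⟩, hq⟩ :=
      ((hα.frequently_exists_num j).and_eventually (eventually_ge_atTop (j + 2))).exists
    refine ⟨q, p, hq, ?_⟩
    have hq' : (0 : ℝ) < q := by exact_mod_cast (by omega : 0 < q)
    have e : q * α - p = q * (α - p / q) := by field_simp
    rw [e, abs_mul, abs_of_pos hq', one_div_pow]
    gcongr
  choose q p hqj hp using hex
  have hq0 : ∀ j, 0 < q j := fun j => by have := hqj j; omega
  have hq1 : ∀ j, (2 : ℝ) ≤ q j := fun j => by
    have := hqj j
    exact_mod_cast (by omega : 2 ≤ q j)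
  -- The exponent n + 1 yields the contraction q^{-n} and keeps r positive even for n = 0.
  set r : ℕ → ℝ := fun j => 1 - (1 / q j) ^ (n + 1) with hrdef
  have hi0 : ∀ j, (0 : ℝ) < 1 / q j := fun j => by have := hq1 j; positivity
  have hi1 : ∀ j, (1 : ℝ) / q j < 1 := fun j => by
    rw [div_lt_one] <;> linarith [hq1 j]
  have hr0 : ∀ j, 0 < r j := fun j => sub_pos.2 (pow_lt_one₀ (hi0 j).le (hi1 j) (by omega))
  have hr1 : ∀ j, r j < 1 := fun j => sub_lt_self _ (pow_pos (hi0 j) _)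
  have hr : ∀ j, |r j| < 1 := fun j => by
    rw [abs_of_pos (hr0 j)]
    exact hr1 j
  have hql : Tendsto q atTop atTop :=
    tendsto_atTop_mono (fun j => by have := hqj j; omega : ∀ j, j ≤ q j) tendsto_id
  have hqr : Tendsto (fun j => (q j : ℝ)) atTop atTop := tendsto_natCast_atTop_atTop.comp hql
  have hil : Tendsto (fun j => (1 : ℝ) / q j) atTop (𝓝 0) := tendsto_const_nhds.div_atTop hqr
  have hsmall : ∀ k : ℕ, Tendsto (fun j => |q j * α - p j| / (1 - r j ^ 2) ^ 2 * (q j : ℝ) ^ k)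
      atTop (𝓝 0) := by
    intro k
    refine squeeze_zero' (Eventually.of_forall fun j => by positivity) ?_ hil
    -- Exponent count: 2(n + 1) pays for (1 - r²)^{-2}, k for q^k, one more for the factor q, and
    -- one is left to give 1/q.
    filter_upwards [eventually_ge_atTop (2 * (n + 1) + k + 2)] with j hj
    have hqp : (0 : ℝ) < q j := by linarith [hq1 j]
    have h1 : (1 / (q j : ℝ)) ^ (n + 1) ≤ 1 - r j ^ 2 := by
      have : (1 / (q j : ℝ)) ^ (n + 1) = 1 - r j := by simp [hrdef]
      rw [this]
      nlinarith [hr0 j, hr1 j]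
    have h2 : ((1 / (q j : ℝ)) ^ (n + 1)) ^ 2 ≤ (1 - r j ^ 2) ^ 2 :=
      pow_le_pow_left₀ (pow_pos (hi0 j) _).le h1 2
    calc |q j * α - p j| / (1 - r j ^ 2) ^ 2 * (q j : ℝ) ^ k
        ≤ (q j * (1 / q j) ^ j) / ((1 / (q j : ℝ)) ^ (n + 1)) ^ 2 * (q j : ℝ) ^ k := by
          gcongr
          exact hp j
      _ ≤ (q j * (1 / q j) ^ (2 * (n + 1) + k + 2)) / ((1 / (q j : ℝ)) ^ (n + 1)) ^ 2
            * (q j : ℝ) ^ k := by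
          have : (1 / (q j : ℝ)) ^ j ≤ (1 / q j) ^ (2 * (n + 1) + k + 2) :=
            pow_le_pow_of_le_one (hi0 j).le (hi1 j).le hj
          have := hi0 j
          gcongr
      _ = 1 / q j := by
          have hv : (q j : ℝ) * (1 / q j) = 1 := mul_one_div_cancel hqp.ne'
          have hX := (pow_pos (pow_pos (hi0 j) (n + 1)) 2).ne'
          have e : (1 / (q j : ℝ)) ^ (2 * (n + 1) + k + 2)
              = ((1 / (q j : ℝ)) ^ (n + 1)) ^ 2 * ((1 / q j) ^ k * (1 / q j) * (1 / q j)) := by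
            ring
          rw [e, mul_left_comm, mul_div_cancel_left₀ _ hX]
          generalize 1 / (q j : ℝ) = v at *
          rw [show q j * (v ^ k * v * v) * (q j : ℝ) ^ k = (q j * v) * v * (q j * v) ^ k by ring, hv]
          simp
  set f : ℕ → CircleDeg1Liftˣ := fun j => mobiusUnit (hr j) (hq0 j) with hf
  have hfs : ∀ j, f j ∈ smoothUnits := fun j => mobiusUnit_mem_smoothUnits _ _
  have hT : ∀ m, TendstoC atTop m (fun j => conjRot (f j) α) (fun x => α + x) :=
    tendstoC_conjRot_mobius hr hq0 hql hsmall
  have hT' : ∀ m, TendstoC atTop m (fun j => conjRot (f j) (-α)) (fun x => -α + x) :=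
    tendstoC_conjRot_mobius (p := fun j => -p j) hr hq0 hql fun k => by
      refine (hsmall k).congr fun j => ?_
      rw [← abs_neg]
      push_cast
      ring_nf
  have hev : ∀ H ∈ K, ∀ᶠ j in atTop,
      (∀ t, |(H * f j) t - H t| ≤ ε) ∧ (∀ s t, |H s - H t| ≤ q j * |s - t|) ∧
        (∀ s t, |s - t| ≤ q j * |H s - H t|) ∧
        ∀ k ≤ n, ∀ t,
          |iteratedDeriv k (conjRot (H * f j) α) t - iteratedDeriv k (conjRot H α) t| ≤ ε ∧
          |iteratedDeriv k (conjRot (H * f j) (-α)) t - iteratedDeriv k (conjRot H (-α)) t|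
            ≤ ε := by
    intro H hH
    have hHs := hKs H hH
    obtain ⟨M, hM⟩ := CircleDeg1Lift.units_exists_lipschitz hHs
    obtain ⟨M', hM'⟩ := CircleDeg1Lift.units_exists_lipschitz (inv_mem hHs)
    have hder : ∀ β, TendstoC atTop n (fun j => conjRot (f j) β) (fun x => β + x) →
        ∀ᶠ j in atTop, ∀ k < n + 1, ∀ t,
          |iteratedDeriv k (conjRot (H * f j) β) t - iteratedDeriv k (conjRot H β) t| ≤ ε := by
      intro β hβ
      refine (eventually_all_finite (finite_lt_nat (n + 1))).2 fun k hk => ?_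
      have := (tendstoC_conjRot_mul hfs hHs hβ).iteratedDeriv (Nat.lt_succ_iff.1 hk)
      filter_upwards [Metric.tendstoUniformly_iff.1 this ε hε] with j hj t
      have := (hj t).le
      rwa [dist_comm, Real.dist_eq] at this
    have hM0 : 0 ≤ M := by simpa using (abs_nonneg _).trans (hM 1 0)
    have hMε : Tendsto (fun j => M * (1 / q j)) atTop (𝓝 0) := by simpa using hil.const_mul M
    filter_upwards [hder α (hT n), hder (-α) (hT' n), hqr.eventually_ge_atTop M,
      hqr.eventually_ge_atTop M', hMε.eventually (gt_mem_nhds hε)] with j h1 h2 h3 h4 h5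
    refine ⟨fun t => ?_, fun s t => ?_, fun s t => ?_, fun k hk t =>
      ⟨h1 k (by omega) t, h2 k (by omega) t⟩⟩
    · have e : (H * f j) t = H (f j t) := by simp [CircleDeg1Lift.mul_apply]
      rw [e]
      refine (hM _ _).trans (le_trans ?_ h5.le)
      gcongr
      refine (abs_mobiusRoot_sub_le (hr j) (hq0 j) t).trans ?_
      have := hq1 j
      gcongr
      linarith
    · exact (hM s t).trans (by gcongr)
    · have := hM' (H s) (H t)
      rw [CircleDeg1Lift.units_inv_apply_apply, CircleDeg1Lift.units_inv_apply_apply] at this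
      exact this.trans (by gcongr)
  obtain ⟨j, hj, hjn⟩ :=
    (((eventually_all_finite hK).2 hev).and (eventually_ge_atTop n)).exists
  refine ⟨f j, hfs j, q j, by have := hqj j; omega, ?_, hj⟩
  refine (mobiusUnit_contraction (hr j) (hq0 j)).trans ?_
  have : 1 - r j = (1 / q j) ^ (n + 1) := by simp [hrdef]
  rw [this]
  exact pow_le_pow_of_le_one (hi0 j).le (hi1 j).le (by omega)

end Stage

/-! ### Infinite products along binary sequences -/

section Limit

open Real

/-- The product of those `f i`, `i < n`, for which `x i` holds. -/
noncomputable def partialProd (f : ℕ → CircleDeg1Liftˣ) (x : ℕ → Bool) : ℕ → CircleDeg1Liftˣ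
  | 0 => 1
  | n + 1 => partialProd f x n * if x n then f n else 1

/-- A sequence of smooth changes of coordinates such that, for every subsequence, the conjugates of
`R_α` and `R_{-α}` by the partial products converge smoothly and the partial products themselves
converge uniformly, with error terms much smaller than the contraction by the `f n`. -/
structure ContractingSequence (α : ℝ) where
  f : ℕ → CircleDeg1Liftˣ
  q : ℕ → ℕ
  c : ℕ → ℝ
  smooth : ∀ n, f n ∈ smoothUnits
  le_q : ∀ n, n + 2 ≤ q n
  contraction : ∀ n, |f n (1 / (4 * q n)) - f n (-(1 / (4 * q n)))| ≤ (1 / q n) ^ n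
  c_pos : ∀ n, 0 < c n
  c_succ : ∀ n, c (n + 1) ≤ c n / 2
  c_le : ∀ n, c (n + 1) ≤ (1 / q n) ^ n / 2
  dist_succ : ∀ x n t, |partialProd f x (n + 1) t - partialProd f x n t| ≤ c n
  lipschitz : ∀ x n s t, |partialProd f x n s - partialProd f x n t| ≤ q n * |s - t|
  antilipschitz : ∀ x n s t, |s - t| ≤ q n * |partialProd f x n s - partialProd f x n t|
  deriv_succ : ∀ x n, ∀ k ≤ n, ∀ t,
    |iteratedDeriv k (conjRot (partialProd f x (n + 1)) α) t
      - iteratedDeriv k (conjRot (partialProd f x n) α) t| ≤ c n ∧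
    |iteratedDeriv k (conjRot (partialProd f x (n + 1)) (-α)) t
      - iteratedDeriv k (conjRot (partialProd f x n) (-α)) t| ≤ c n

/-- The recursion carries the finite set of partial products over all binary prefixes, because f_n
and q_n must serve every prefix at once, together with the current tolerance. The next tolerance is
at most half of the present one and of q^{-n}, so later stages cannot undo the contraction. -/
theorem Liouville.nonempty_contractingSequence {α : ℝ} (hα : Liouville α) :
    Nonempty (ContractingSequence α) := by
  let σ := {s : Set CircleDeg1Liftˣ × ℝ // s.1.Finite ∧ (∀ H ∈ s.1, H ∈ smoothUnits) ∧ 0 < s.2}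
  have key := fun (n : ℕ) (s : σ) => hα.exists_contracting_perturbation s.2.1 s.2.2.1 n s.2.2.2
  choose f hf q hq hc hK using key
  have hqpos : ∀ n s, (0 : ℝ) < q n s := fun n s => by
    have := hq n s
    exact_mod_cast (by omega : 0 < q n s)
  let st : ℕ → σ := fun n => Nat.rec
    ⟨({1}, 1), finite_singleton _, by
      rintro H rfl
      exact one_mem smoothUnits, one_pos⟩
    (fun n s => ⟨(s.1.1 ∪ (fun H => H * f n s) '' s.1.1, min (s.1.2 / 2) ((1 / q n s) ^ n / 2)),
      s.2.1.union (s.2.1.image _), by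
        rintro H (h | ⟨H, h, rfl⟩)
        · exact s.2.2.1 H h
        · exact mul_mem (s.2.2.1 H h) (hf n s),
      lt_min (half_pos s.2.2.2)
        (half_pos (pow_pos (one_div_pos.2 (hqpos n s)) n))⟩) n
  set F : ℕ → CircleDeg1Liftˣ := fun n => f n (st n) with hF
  have hmem : ∀ x n, partialProd F x n ∈ (st n).1.1 := by
    intro x n
    induction n with
    | zero => exact mem_singleton _
    | succ n ih =>
      rw [partialProd]
      split_ifs
      · exact Or.inr ⟨_, ih, rfl⟩
      · rw [mul_one]
        exact Or.inl ih
  refine ⟨⟨F, fun n => q n (st n), fun n => (st n).1.2, fun n => hf _ _, fun n => hq _ _,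
    fun n => hc _ _, fun n => (st n).2.2.2, fun n => min_le_left _ _, fun n => min_le_right _ _,
    fun x n t => ?_, fun x n => (hK n (st n) _ (hmem x n)).2.1,
    fun x n => (hK n (st n) _ (hmem x n)).2.2.1, fun x n k hk t => ?_⟩⟩
  · rw [partialProd]
    split_ifs
    · exact (hK n (st n) _ (hmem x n)).1 t
    · simpa using (st n).2.2.2.le
  · rw [partialProd]
    split_ifs
    · exact (hK n (st n) _ (hmem x n)).2.2.2 k hk t
    · simpa using (st n).2.2.2.le

theorem tendsto_zero_of_le_half {c : ℕ → ℝ} (hc : ∀ n, 0 < c n) (hc2 : ∀ n, c (n + 1) ≤ c n / 2) :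
    Tendsto c atTop (𝓝 0) := by
  have hb : ∀ n, c n ≤ c 0 * (1 / 2) ^ n := by
    intro n
    induction n with
    | zero => simp
    | succ n ih =>
      rw [pow_succ]
      linarith [hc2 n]
  refine squeeze_zero (fun n => (hc n).le) hb ?_
  simpa using (tendsto_pow_atTop_nhds_zero_of_lt_one (r := (1 / 2 : ℝ)) (by norm_num)
    (by norm_num)).const_mul (c 0)

theorem exists_limit_of_dist_le {c : ℕ → ℝ} (hc : ∀ n, 0 < c n) (hc2 : ∀ n, c (n + 1) ≤ c n / 2)
    {a : ℕ → ℝ} {N : ℕ} (h : ∀ n, N ≤ n → |a (n + 1) - a n| ≤ c n) :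
    ∃ L, ∀ n, N ≤ n → |L - a n| ≤ 2 * c n := by
  -- Subtracting 2 c m turns the telescoped geometric bound into one that survives induction.
  have key : ∀ n, N ≤ n → ∀ m, n ≤ m → |a m - a n| ≤ 2 * c n - 2 * c m := by
    intro n hn m hm
    induction m, hm using Nat.le_induction with
    | base => simp
    | succ m hm ih =>
      have h1 := h m (hn.trans hm)
      have h2 := hc2 m
      have h3 := abs_sub_le (a (m + 1)) (a m) (a n)
      linarith
  have hc0 := tendsto_zero_of_le_half hc hc2
  have hcau : CauchySeq a := by
    refine Metric.cauchySeq_iff'.2 fun ε hε => ?_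
    obtain ⟨n, hn, hn'⟩ := ((hc0.eventually (gt_mem_nhds (half_pos hε))).and
      (eventually_ge_atTop N)).exists
    refine ⟨n, fun m hm => ?_⟩
    rw [Real.dist_eq]
    linarith [key n hn' m hm, hc m]
  obtain ⟨L, hL⟩ := cauchySeq_tendsto_of_complete hcau
  refine ⟨L, fun n hn => ?_⟩
  refine le_of_tendsto (hL.sub_const (a n)).abs ?_
  filter_upwards [eventually_ge_atTop n] with m hm
  linarith [key n hn m hm, hc m]

theorem tendstoUniformly_of_le {c : ℕ → ℝ} (hc0 : Tendsto c atTop (𝓝 0)) {F : ℕ → ℝ → ℝ}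
    {f : ℝ → ℝ} {N : ℕ} (h : ∀ n, N ≤ n → ∀ t, |f t - F n t| ≤ 2 * c n) :
    TendstoUniformly F f atTop := by
  rw [Metric.tendstoUniformly_iff]
  intro ε hε
  filter_upwards [hc0.eventually (gt_mem_nhds (half_pos hε)), eventually_ge_atTop N]
    with n hn hn' t
  rw [Real.dist_eq]
  linarith [h n hn' t]

theorem exists_smooth_limit {c : ℕ → ℝ} (hc : ∀ n, 0 < c n) (hc2 : ∀ n, c (n + 1) ≤ c n / 2)
    {F : ℕ → ℝ → ℝ} (hF : ∀ n, ContDiff ℝ ∞ (F n))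
    (h : ∀ n, ∀ k ≤ n, ∀ t, |iteratedDeriv k (F (n + 1)) t - iteratedDeriv k (F n) t| ≤ c n) :
    ∃ G, ContDiff ℝ ∞ G ∧
      ∀ n, ∀ k ≤ n, ∀ t, |iteratedDeriv k G t - iteratedDeriv k (F n) t| ≤ 2 * c n := by
  have key : ∀ k t, ∃ L, ∀ n, k ≤ n → |L - iteratedDeriv k (F n) t| ≤ 2 * c n := fun k t =>
    exists_limit_of_dist_le hc hc2 fun n hn => h n k hn t
  choose g hg using key
  have hunif : ∀ k, TendstoUniformly (fun n => iteratedDeriv k (F n)) (g k) atTop := fun k =>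
    tendstoUniformly_of_le (N := k) (tendsto_zero_of_le_half hc hc2) fun n hn t => hg k t n hn
  have hder : ∀ k t, HasDerivAt (g k) (g (k + 1) t) t := fun k =>
    hasDerivAt_of_tendstoUniformly (hunif (k + 1)) (Eventually.of_forall fun n t => by
      rw [iteratedDeriv_succ]
      exact ((hF n).differentiable_iteratedDeriv k (by
        exact_mod_cast WithTop.coe_lt_top _) t).hasDerivAt)
      fun t => (hunif k).tendsto_at t
  have hit : ∀ k, iteratedDeriv k (g 0) = g k := by
    intro k
    induction k with
    | zero => simp
    | succ k ih =>
      rw [iteratedDeriv_succ, ih]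
      exact funext fun t => (hder k t).deriv
  refine ⟨g 0, contDiff_of_differentiable_iteratedDeriv fun k _ => ?_, fun n k hk t => ?_⟩
  · rw [hit]
    exact fun t => (hder k t).differentiableAt
  · rw [hit]
    exact hg k t n hk

theorem conjRot_inv (H : CircleDeg1Liftˣ) (β : ℝ) : (conjRot H β)⁻¹ = conjRot H (-β) := by
  have e : rot (-β) = (rot β)⁻¹ := by rw [rot, rot, ofAdd_neg, map_inv]
  rw [conjRot, conjRot, e]
  group

theorem conjRot_conj (H : CircleDeg1Liftˣ) (β t : ℝ) : conjRot H β (H t) = H (β + t) := by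
  rw [conjRot_apply, CircleDeg1Lift.units_inv_apply_apply]

/-- A pointwise limit of lifts as a lift. -/
def CircleDeg1Lift.ofTendsto {F : ℕ → CircleDeg1Lift} {g : ℝ → ℝ}
    (h : ∀ t, Tendsto (fun n => F n t) atTop (𝓝 (g t))) : CircleDeg1Lift where
  toFun := g
  monotone' _ _ hst := le_of_tendsto_of_tendsto' (h _) (h _) fun n => (F n).monotone hst
  map_add_one' t := tendsto_nhds_unique (h _)
    (by simpa only [CircleDeg1Lift.map_add_one] using (h t).add_const 1)

namespace ContractingSequence

variable {α : ℝ} (D : ContractingSequence α)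

theorem partialProd_mem (x : ℕ → Bool) (n : ℕ) : partialProd D.f x n ∈ smoothUnits := by
  induction n with
  | zero => exact one_mem _
  | succ n ih =>
    rw [partialProd]
    split_ifs
    · exact mul_mem ih (D.smooth n)
    · exact mul_mem ih (one_mem _)

theorem tendsto_c : Tendsto D.c atTop (𝓝 0) := tendsto_zero_of_le_half D.c_pos D.c_succ

/-- The conjugates of R_{-α} are the inverses of those of R_α. Following both sequences makes the
two limits mutually inverse, so the limit is a diffeomorphism and not merely a smooth map. -/
theorem exists_limit (x : ℕ → Bool) : ∃ S ∈ smoothUnits, ∀ n, ∀ k ≤ n, ∀ t,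
    |iteratedDeriv k S t - iteratedDeriv k (conjRot (partialProd D.f x n) α) t| ≤ 2 * D.c n ∧
    |iteratedDeriv k (S⁻¹ : CircleDeg1Liftˣ) t
      - iteratedDeriv k (conjRot (partialProd D.f x n) (-α)) t| ≤ 2 * D.c n := by
  obtain ⟨G, hG, hGl⟩ := exists_smooth_limit D.c_pos D.c_succ
    (fun n => (conjRot_mem_smoothUnits (D.partialProd_mem x n) α).1)
    fun n k hk t => (D.deriv_succ x n k hk t).1
  obtain ⟨G', hG', hGl'⟩ := exists_smooth_limit D.c_pos D.c_succ
    (fun n => (conjRot_mem_smoothUnits (D.partialProd_mem x n) (-α)).1)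
    fun n k hk t => (D.deriv_succ x n k hk t).2
  have hu : TendstoUniformly (fun n => (conjRot (partialProd D.f x n) α : ℝ → ℝ)) G atTop :=
    tendstoUniformly_of_le (N := 0) D.tendsto_c fun n _ t => by simpa using hGl n 0 n.zero_le t
  have hu' : TendstoUniformly (fun n => (conjRot (partialProd D.f x n) (-α) : ℝ → ℝ)) G' atTop :=
    tendstoUniformly_of_le (N := 0) D.tendsto_c fun n _ t => by simpa using hGl' n 0 n.zero_le t
  let S : CircleDeg1Liftˣ :=
    { val := CircleDeg1Lift.ofTendsto hu.tendsto_at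
      inv := CircleDeg1Lift.ofTendsto hu'.tendsto_at
      val_inv := CircleDeg1Lift.ext fun t => by
        refine tendsto_nhds_unique
          (hu.tendsto_comp hG.continuous.continuousAt (hu'.tendsto_at t)) ?_
        simp only [← conjRot_inv, CircleDeg1Lift.units_apply_inv_apply]
        exact tendsto_const_nhds
      inv_val := CircleDeg1Lift.ext fun t => by
        refine tendsto_nhds_unique
          (hu'.tendsto_comp hG'.continuous.continuousAt (hu.tendsto_at t)) ?_
        simp only [← conjRot_inv, CircleDeg1Lift.units_inv_apply_apply]
        exact tendsto_const_nhds }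
  exact ⟨S, ⟨hG, hG'⟩, fun n k hk t => ⟨hGl n k hk t, hGl' n k hk t⟩⟩

/-- The limit of the conjugates of `R_α` by the partial products. -/
noncomputable def limit (x : ℕ → Bool) : CircleDeg1Liftˣ := (D.exists_limit x).choose

theorem limit_mem (x : ℕ → Bool) : D.limit x ∈ smoothUnits := (D.exists_limit x).choose_spec.1

theorem limit_spec (x : ℕ → Bool) {n k : ℕ} (hk : k ≤ n) (t : ℝ) :
    |iteratedDeriv k (D.limit x) t - iteratedDeriv k (conjRot (partialProd D.f x n) α) t|
      ≤ 2 * D.c n ∧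
    |iteratedDeriv k ((D.limit x)⁻¹ : CircleDeg1Liftˣ) t
      - iteratedDeriv k (conjRot (partialProd D.f x n) (-α)) t| ≤ 2 * D.c n :=
  (D.exists_limit x).choose_spec.2 n k hk t

theorem tendstoUniformly_limit (x : ℕ → Bool) :
    TendstoUniformly (fun n => (conjRot (partialProd D.f x n) α : ℝ → ℝ)) (D.limit x) atTop :=
  tendstoUniformly_of_le (N := 0) D.tendsto_c fun n _ t => by
    simpa using (D.limit_spec x n.zero_le t).1

/-- The partial products converge uniformly, though not smoothly, and the conjugacy equation passes
to the limit. Invertibility of the limit is never needed. -/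
theorem exists_semiconj (x : ℕ → Bool) : ∃ H : CircleDeg1Lift, Continuous H ∧
    (∀ n t, |H t - partialProd D.f x n t| ≤ 2 * D.c n) ∧
    ∀ t, D.limit x (H t) = H (α + t) := by
  have key : ∀ t, ∃ L, ∀ n, 0 ≤ n → |L - partialProd D.f x n t| ≤ 2 * D.c n := fun t =>
    exists_limit_of_dist_le D.c_pos D.c_succ fun n _ => D.dist_succ x n t
  choose g hg using key
  have hu : TendstoUniformly (fun n => (partialProd D.f x n : ℝ → ℝ)) g atTop :=
    tendstoUniformly_of_le D.tendsto_c fun n hn t => hg t n hn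
  have hcont : Continuous g := hu.continuous
    (Frequently.of_forall fun n => (D.partialProd_mem x n).1.continuous)
  refine ⟨CircleDeg1Lift.ofTendsto hu.tendsto_at, hcont, fun n t => hg t n n.zero_le,
    fun t => ?_⟩
  refine tendsto_nhds_unique ((D.tendstoUniformly_limit x).tendsto_comp
    (D.limit_mem x).1.continuous.continuousAt (hu.tendsto_at t)) ?_
  simp only [conjRot_conj]
  exact hu.tendsto_at _

/-- The factors after stage n are common to both products and cancel, so one fixed smooth U
conjugates the approximants at every stage m ≥ n, and hence their limits. -/
theorem limit_conj {x y : ℕ → Bool} {n : ℕ} (h : ∀ i, n ≤ i → x i = y i) (t : ℝ) :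
    D.limit x (partialProd D.f x n ((partialProd D.f y n)⁻¹ t))
      = partialProd D.f x n ((partialProd D.f y n)⁻¹ (D.limit y t)) := by
  have key : ∀ m, n ≤ m → partialProd D.f x m * (partialProd D.f y m)⁻¹
      = partialProd D.f x n * (partialProd D.f y n)⁻¹ := by
    intro m hm
    induction m, hm using Nat.le_induction with
    | base => rfl
    | succ m hm ih =>
      rw [← ih, partialProd, partialProd, h m hm]
      group
  set U := partialProd D.f x n * (partialProd D.f y n)⁻¹ with hU
  have happ : ∀ s, partialProd D.f x n ((partialProd D.f y n)⁻¹ s) = U s := fun s => by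
    simp [hU, CircleDeg1Lift.mul_apply]
  have hUs : Continuous U :=
    (mul_mem (D.partialProd_mem x n) (inv_mem (D.partialProd_mem y n)) : U ∈ _).1.continuous
  rw [happ, happ]
  refine tendsto_nhds_unique ((D.tendstoUniformly_limit x).tendsto_at (U t)) ?_
  refine Tendsto.congr' ?_
    ((hUs.tendsto _).comp ((D.tendstoUniformly_limit y).tendsto_at t))
  filter_upwards [eventually_ge_atTop n] with m hm
  have e : U * conjRot (partialProd D.f y m) α = conjRot (partialProd D.f x m) α * U := by
    rw [← key m hm, conjRot, conjRot]
    group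
  have := congrArg (fun u : CircleDeg1Liftˣ => u t) e
  simpa [CircleDeg1Lift.mul_apply] using this

end ContractingSequence

end Limit

/-! ### Kolmogorov's zero-one law for coin tosses -/

section ZeroOne

open MeasureTheory ProbabilityTheory

/-- The distribution of a fair coin. -/
noncomputable def coin : Measure Bool :=
  (2⁻¹ : ENNReal) • (Measure.dirac true + Measure.dirac false)

instance : IsProbabilityMeasure coin := ⟨by
  simp [coin, ENNReal.inv_two_add_inv_two]⟩

theorem coin_map_not : coin.map Bool.not = coin := by
  rw [coin, Measure.map_smul, Measure.map_add _ _ (measurable_of_countable _),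
    Measure.map_dirac' (measurable_of_countable _), Measure.map_dirac' (measurable_of_countable _)]
  simp [add_comm]

theorem measurePreserving_infinitePi_not :
    MeasurePreserving (fun (x : ℕ → Bool) n => (x n).not) (Measure.infinitePi fun _ => coin)
      (Measure.infinitePi fun _ => coin) := by
  refine ⟨by fun_prop, ?_⟩
  rw [Measure.infinitePi_map_pi (fun _ : ℕ => coin) (fun _ => measurable_of_countable Bool.not)]
  simp only [coin_map_not]

/-- A measurable function on `ℕ → Bool` which does not depend on finitely many coordinates takes
the same value at two points which differ infinitely often. -/
theorem exists_eq_of_tail_invariant {φ : (ℕ → Bool) → ℝ} (hφ : Measurable φ)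
    (h : ∀ x y n, (∀ i, n ≤ i → x i = y i) → φ x = φ y) :
    ∃ x y, φ x = φ y ∧ ∃ᶠ n in atTop, x n = false ∧ y n = true := by
  set μ : Measure (ℕ → Bool) := Measure.infinitePi fun _ => coin with hμ
  set s : ℕ → MeasurableSpace (ℕ → Bool) := fun n =>
    MeasurableSpace.comap (fun x => x n) inferInstance with hs
  have hle : ∀ n, s n ≤ MeasurableSpace.pi := fun n => (measurable_pi_apply n).comap_le
  have hind : iIndep s μ :=
    iIndepFun_infinitePi (P := fun _ : ℕ => coin) (X := fun _ b => b) fun _ => measurable_id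
  have htail : ∀ U : Set ℝ, MeasurableSet U → MeasurableSet[limsup s atTop] (φ ⁻¹' U) := by
    intro U hU
    rw [limsup_eq_iInf_iSup_of_nat, MeasurableSpace.measurableSet_iInf]
    intro n
    have hm : Measurable[⨆ i ≥ n, s i]
        (fun (x : ℕ → Bool) i => if n ≤ i then x i else false) := by
      refine @measurable_pi_lambda _ _ _ (⨆ i ≥ n, s i) _ _ fun i => ?_
      by_cases hi : n ≤ i
      · simp only [hi, if_true]
        exact measurable_iff_comap_le.2 (le_iSup₂_of_le i hi le_rfl)
      · simp only [hi, if_false]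
        exact @measurable_const _ _ _ (_) _
    -- Tail invariance allows the first n coordinates to be reset to `false`, which exhibits the
    -- preimage as an event of the coordinates from n on.
    have e : φ ⁻¹' U = (fun (x : ℕ → Bool) i => if n ≤ i then x i else false) ⁻¹' (φ ⁻¹' U) := by
      ext x
      rw [mem_preimage, mem_preimage, mem_preimage,
        h x (fun i => if n ≤ i then x i else false) n fun i hi => by simp [hi]]
    rw [e]
    exact hm (hφ hU)
  obtain ⟨a, ha⟩ : ∃ a, φ =ᵐ[μ] Function.const _ a :=
    exists_eventuallyEq_const_of_forall_separating MeasurableSet fun U hU => by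
      rcases measure_zero_or_one_of_measurableSet_limsup_atTop hle hind (htail U hU) with h0 | h1
      · exact Or.inr (measure_eq_zero_iff_ae_notMem.1 h0)
      · exact Or.inl ((mem_ae_iff_prob_eq_one (hφ hU)).2 h1)
  -- The flip preserves the measure, so almost every x is generic together with its complement.
  obtain ⟨x, hx, hx'⟩ :=
    (ha.and (measurePreserving_infinitePi_not.quasiMeasurePreserving.ae ha)).exists
  have hfr : (∃ᶠ n in atTop, x n = false) ∨ ∃ᶠ n in atTop, x n = true := by
    rw [← frequently_or_distrib]
    exact Frequently.of_forall fun n => by simp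
  rcases hfr with hfr | hfr
  · exact ⟨x, fun n => (x n).not, hx.trans hx'.symm, hfr.mono fun n hn => by simp [hn]⟩
  · exact ⟨fun n => (x n).not, x, hx'.trans hx.symm, hfr.mono fun n hn => by simp [hn]⟩

end ZeroOne

/-! ### Passage to the circle: rotation number, continuity, conjugacy of tail-equivalent sequences
-/

section Circle

/-- The circle map induced by a degree one lift. -/
def inducedCircleMap (F : CircleDeg1Lift) : UnitAddCircle → UnitAddCircle :=
  Function.Periodic.lift (f := fun t : ℝ => ((F t : ℝ) : UnitAddCircle)) (c := 1) fun t => by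
    simp

theorem CircleDeg1Lift.continuous_units (u : CircleDeg1Liftˣ) : Continuous u := by
  rw [← CircleDeg1Lift.coe_toOrderIso]
  exact (CircleDeg1Lift.toOrderIso u).continuous

theorem continuous_inducedCircleMap {F : CircleDeg1Lift} (hF : Continuous F) :
    Continuous (inducedCircleMap F) := by
  refine (QuotientAddGroup.isQuotientMap_mk (N := AddSubgroup.zmultiples (1 : ℝ))).continuous_iff.2
    ?_
  exact (AddCircle.continuous_mk' (1 : ℝ)).comp hF

/-- The circle homeomorphism with a given invertible lift. -/
def circleHomeo (u : CircleDeg1Liftˣ) : UnitAddCircle ≃ₜ UnitAddCircle where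
  toFun := inducedCircleMap u
  invFun := inducedCircleMap (u⁻¹ : CircleDeg1Liftˣ)
  left_inv z := by
    induction z using QuotientAddGroup.induction_on with
    | H t => exact congrArg _ (CircleDeg1Lift.units_inv_apply_apply u t)
  right_inv z := by
    induction z using QuotientAddGroup.induction_on with
    | H t => exact congrArg _ (CircleDeg1Lift.units_apply_inv_apply u t)
  continuous_toFun := continuous_inducedCircleMap (CircleDeg1Lift.continuous_units u)
  continuous_invFun := continuous_inducedCircleMap (CircleDeg1Lift.continuous_units u⁻¹)

theorem circleHomeo_coe (u : CircleDeg1Liftˣ) (t : ℝ) :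
    circleHomeo u (t : UnitAddCircle) = ((u t : ℝ) : UnitAddCircle) := rfl

theorem isCircleLift_circleHomeo (u : CircleDeg1Liftˣ) : IsCircleLift u (circleHomeo u) :=
  ⟨CircleDeg1Lift.continuous_units u, fun _ => rfl⟩

theorem isCircleLift_circleHomeo_symm (u : CircleDeg1Liftˣ) :
    IsCircleLift (u⁻¹ : CircleDeg1Liftˣ) (circleHomeo u).symm :=
  ⟨CircleDeg1Lift.continuous_units u⁻¹, fun _ => rfl⟩

theorem circleHomeo_mem {u : CircleDeg1Liftˣ} (hu : u ∈ smoothUnits) :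
    circleHomeo u ∈ smoothCircleDiffeos :=
  ⟨⟨u, isCircleLift_circleHomeo u, hu.1⟩, _, isCircleLift_circleHomeo_symm u, hu.2⟩

theorem UnitAddCircle.dist_coe_le (s t : ℝ) :
    dist (s : UnitAddCircle) (t : UnitAddCircle) ≤ |s - t| := by
  rw [dist_eq_norm, ← AddCircle.coe_sub, UnitAddCircle.norm_eq]
  simpa using round_le (s - t) 0

theorem UnitAddCircle.le_dist_coe {s t d : ℝ} (h1 : d ≤ s - t) (h2 : s - t ≤ 1 - d) :
    d ≤ dist (s : UnitAddCircle) (t : UnitAddCircle) := by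
  rw [dist_eq_norm, ← AddCircle.coe_sub, UnitAddCircle.norm_eq]
  generalize s - t = y at *
  rcases le_or_gt (round y) 0 with h | h
  · have : (round y : ℝ) ≤ 0 := by exact_mod_cast h
    exact le_trans (by linarith) (le_abs_self _)
  · have : (1 : ℝ) ≤ round y := by exact_mod_cast h
    exact le_trans (by linarith) (neg_le_abs _)

theorem continuous_ofFun_of_prefix {X : Type*} {E : Type*} [PseudoMetricSpace E]
    {g : (ℕ → Bool) → X → E}
    (h : ∀ ε > 0, ∃ n, ∀ x y : ℕ → Bool, (∀ i < n, x i = y i) → ∀ t, dist (g x t) (g y t) < ε) :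
    Continuous fun x => UniformFun.ofFun (g x) := by
  rw [continuous_iff_continuousAt]
  intro x
  rw [ContinuousAt, UniformFun.tendsto_iff_tendstoUniformly, Metric.tendstoUniformly_iff]
  intro ε hε
  obtain ⟨n, hn⟩ := h ε hε
  have hev : ∀ᶠ y : ℕ → Bool in 𝓝 x, ∀ i < n, x i = y i := by
    refine (eventually_all_finite (finite_lt_nat n)).2 fun i _ => ?_
    have := (continuous_apply i).continuousAt.eventually
      ((isOpen_discrete {x i}).mem_nhds (mem_singleton (x i)) :
        ∀ᶠ b in 𝓝 (x i), b ∈ ({x i} : Set Bool))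
    exact this.mono fun y hy => hy.symm
  exact hev.mono fun y hy t => hn x y hy t

namespace ContractingSequence

variable {α : ℝ} (D : ContractingSequence α)

/-- The limit diffeomorphism attached to a subsequence. -/
noncomputable def diffeo (x : ℕ → Bool) : SmoothCircleDiffeo :=
  ⟨circleHomeo (D.limit x), circleHomeo_mem (D.limit_mem x)⟩

theorem diffeo_toHomeo (x : ℕ → Bool) : (D.diffeo x).toHomeo = circleHomeo (D.limit x) := rfl

/-- Translation numbers are invariant under semiconjugacy by a degree one lift, so that of R_α is
inherited. -/
theorem hasRotationNumber_diffeo (x : ℕ → Bool) :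
    HasRotationNumber (D.diffeo x).toHomeo (α : UnitAddCircle) := by
  obtain ⟨H, -, -, hH⟩ := D.exists_semiconj x
  refine ⟨D.limit x, isCircleLift_circleHomeo _, ?_⟩
  have : Function.Semiconj H (rot α : CircleDeg1Liftˣ) (D.limit x) := fun t => by
    rw [CircleDeg1Lift.translate_apply, hH]
  rw [← CircleDeg1Lift.translationNumber_eq_of_semiconj this,
    CircleDeg1Lift.translationNumber_translate]

theorem partialProd_congr (f : ℕ → CircleDeg1Liftˣ) {x y : ℕ → Bool} {n : ℕ}
    (h : ∀ i < n, x i = y i) : partialProd f x n = partialProd f y n := by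
  induction n with
  | zero => rfl
  | succ n ih => rw [partialProd, partialProd, ih fun i hi => h i (by omega), h n (by omega)]

/-- Sequences with the same first n entries share the stage-n approximant, and each limit lies
within 2 c n of it. -/
theorem exists_prefix (k : ℕ) {ε : ℝ} (hε : 0 < ε) :
    ∃ n, ∀ x y : ℕ → Bool, (∀ i < n, x i = y i) → ∀ t,
      |iteratedDeriv k (D.limit x) t - iteratedDeriv k (D.limit y) t| < ε ∧
      |iteratedDeriv k ((D.limit x)⁻¹ : CircleDeg1Liftˣ) t
        - iteratedDeriv k ((D.limit y)⁻¹ : CircleDeg1Liftˣ) t| < ε := by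
  obtain ⟨n, hn, hk⟩ := ((D.tendsto_c.eventually (gt_mem_nhds (by positivity : 0 < ε / 4))).and
    (eventually_ge_atTop k)).exists
  refine ⟨n, fun x y h t => ?_⟩
  have h1 := D.limit_spec x hk t
  have h2 := D.limit_spec y hk t
  rw [partialProd_congr D.f h] at h1
  have key : ∀ {a b d : ℝ}, |a - d| ≤ 2 * D.c n → |b - d| ≤ 2 * D.c n → |a - b| < ε := by
    intro a b d ha hb
    have := abs_sub_le a d b
    rw [abs_sub_comm d b] at this
    linarith
  exact ⟨key h1.1 h2.1, key h1.2 h2.2⟩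

theorem continuous_diffeo : Continuous D.diffeo := by
  have e1 : ∀ k x, iteratedDeriv (k + 1) (D.diffeo x).lift = iteratedDeriv (k + 1) (D.limit x) :=
    fun k x => (D.diffeo x).lift_spec.1.iteratedDeriv_eq (isCircleLift_circleHomeo _) k
  have e2 : ∀ k x, iteratedDeriv (k + 1) (D.diffeo x).inv.lift
      = iteratedDeriv (k + 1) ((D.limit x)⁻¹ : CircleDeg1Liftˣ) := fun k x =>
    (D.diffeo x).inv.lift_spec.1.iteratedDeriv_eq (isCircleLift_circleHomeo_symm _) k
  refine continuous_inf_rng.2 ⟨continuous_inf_rng.2 ⟨continuous_induced_rng.2 ?_,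
    continuous_iInf_rng.2 fun k => continuous_induced_rng.2 ?_⟩,
    continuous_inf_rng.2 ⟨continuous_induced_rng.2 ?_,
    continuous_iInf_rng.2 fun k => continuous_induced_rng.2 ?_⟩⟩
  · refine continuous_ofFun_of_prefix fun ε hε => ?_
    obtain ⟨n, hn⟩ := D.exists_prefix 0 hε
    refine ⟨n, fun x y h z => ?_⟩
    induction z using QuotientAddGroup.induction_on with
    | H t => exact (UnitAddCircle.dist_coe_le _ _).trans_lt (by simpa using (hn x y h t).1)
  · refine continuous_ofFun_of_prefix fun ε hε => ?_
    obtain ⟨n, hn⟩ := D.exists_prefix (k + 1) hε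
    refine ⟨n, fun x y h t => ?_⟩
    rw [e1, e1]
    exact (hn x y h t).1
  · refine continuous_ofFun_of_prefix fun ε hε => ?_
    obtain ⟨n, hn⟩ := D.exists_prefix 0 hε
    refine ⟨n, fun x y h z => ?_⟩
    induction z using QuotientAddGroup.induction_on with
    | H t => exact (UnitAddCircle.dist_coe_le _ _).trans_lt (by simpa using (hn x y h t).2)
  · refine continuous_ofFun_of_prefix fun ε hε => ?_
    obtain ⟨n, hn⟩ := D.exists_prefix (k + 1) hε
    refine ⟨n, fun x y h t => ?_⟩
    rw [e2, e2]
    exact (hn x y h t).2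

theorem conjugateBy_of_eventually_eq {𝒟 : Set (UnitAddCircle ≃ₜ UnitAddCircle)}
    (h𝒟 : smoothCircleDiffeos ⊆ 𝒟) {x y : ℕ → Bool} {n : ℕ} (h : ∀ i, n ≤ i → x i = y i) :
    ConjugateBy 𝒟 (D.diffeo x).toHomeo (D.diffeo y).toHomeo := by
  set U := partialProd D.f x n * (partialProd D.f y n)⁻¹ with hU
  refine ⟨circleHomeo U, h𝒟 (circleHomeo_mem
    (mul_mem (D.partialProd_mem x n) (inv_mem (D.partialProd_mem y n)))), fun z => ?_⟩
  induction z using QuotientAddGroup.induction_on with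
  | H t =>
    rw [D.diffeo_toHomeo, D.diffeo_toHomeo]
    have h1 := D.limit_conj h (U⁻¹ t)
    have happ : ∀ s, partialProd D.f x n ((partialProd D.f y n)⁻¹ s) = U s := fun s => by
      simp [hU, CircleDeg1Lift.mul_apply]
    rw [happ, happ, CircleDeg1Lift.units_apply_inv_apply] at h1
    exact congrArg _ h1

end ContractingSequence

end Circle

/-! ### Hölder obstruction for sequences that differ infinitely often -/

section NotConjugate

/-- Two continuous semiconjugacies from an irrational rotation to the same injective map, which
agree at a point, agree. -/
theorem eq_of_semiconj_irrational {X : Type*} [TopologicalSpace X] [T2Space X] {α : ℝ}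
    (hα : Irrational α) {S : X → X} (hS : Injective S) {u v : ℝ → X} (hu : Continuous u)
    (hv : Continuous v) (pu : Periodic u 1) (pv : Periodic v 1) (su : ∀ t, S (u t) = u (α + t))
    (sv : ∀ t, S (v t) = v (α + t)) (h0 : u 0 = v 0) : u = v := by
  have hm : ∀ m : ℤ, u (m * α) = v (m * α) := by
    intro m
    induction m using Int.induction_on with
    | zero => simpa using h0
    | succ m ih =>
      have e : ((m + 1 : ℤ) : ℝ) * α = α + (m : ℤ) * α := by push_cast; ring
      rw [e, ← su, ← sv, ih]
    | pred m ih =>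
      -- Going backwards along the orbit needs injectivity, as S cannot be inverted explicitly.
      apply hS
      have e : α + ((-m - 1 : ℤ) : ℝ) * α = (-m : ℤ) * α := by push_cast; ring
      rw [su, sv, e, ih]
  have hd : Dense (AddSubgroup.closure {α, 1} : Set ℝ) :=
    dense_addSubgroupClosure_pair_iff.2 (by simpa using hα)
  refine Continuous.ext_on hd hu hv fun t ht => ?_
  obtain ⟨m, n, rfl⟩ := AddSubgroup.mem_closure_pair.1 ht
  have e : m • α + n • (1 : ℝ) = m * α + n * 1 := by simp
  rw [e, pu.int_mul n, pv.int_mul n, hm]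

namespace ContractingSequence

variable {α : ℝ} (D : ContractingSequence α)

theorem add_two_le_q (n : ℕ) : (n : ℝ) + 2 ≤ D.q n := by exact_mod_cast D.le_q n

theorem partialProd_succ_true {x : ℕ → Bool} {n : ℕ} (h : x n = true) (t : ℝ) :
    partialProd D.f x (n + 1) t = partialProd D.f x n (D.f n t) := by
  simp [partialProd, h, CircleDeg1Lift.mul_apply]

theorem partialProd_succ_false {x : ℕ → Bool} {n : ℕ} (h : x n = false) :
    partialProd D.f x (n + 1) = partialProd D.f x n := by
  simp [partialProd, h]

/-- The factor f_n brings the points within q^{-n}, the earlier product expands by at most q, and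
the tail adds at most 2q^{-n}. The total (q + 2) q^{-n} is absorbed by q² q^{-n}. -/
theorem contracted_dist {H : CircleDeg1Lift} {y : ℕ → Bool}
    (hH : ∀ n t, |H t - partialProd D.f y n t| ≤ 2 * D.c n) {n : ℕ} (hn : 2 ≤ n)
    (hy : y n = true) :
    |H (1 / (4 * D.q n)) - H (-(1 / (4 * D.q n)))| ≤ (1 / D.q n) ^ (n - 2) := by
  have h1 := hH (n + 1) (1 / (4 * D.q n))
  have h2 := hH (n + 1) (-(1 / (4 * D.q n)))
  rw [D.partialProd_succ_true hy] at h1 h2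
  have h3 := (D.lipschitz y n _ _).trans
    (mul_le_mul_of_nonneg_left (D.contraction n) (D.q n).cast_nonneg)
  have h4 := D.c_le n
  have hq := D.add_two_le_q n
  have hn' : (2 : ℝ) ≤ n := by exact_mod_cast hn
  have hq0 : (0 : ℝ) < D.q n := by linarith
  have e : (1 / (D.q n : ℝ)) ^ (n - 2) = D.q n * D.q n * (1 / D.q n) ^ n := by
    obtain ⟨m, rfl⟩ : ∃ m, n = m + 2 := ⟨n - 2, by omega⟩
    rw [Nat.add_sub_cancel, pow_add]
    field_simp
  have hp : 0 < (1 / (D.q n : ℝ)) ^ n := by positivity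
  rw [e]
  have h5 := abs_sub_le (H (1 / (4 * D.q n))) (partialProd D.f y n (D.f n (1 / (4 * D.q n))))
    (H (-(1 / (4 * D.q n))))
  have h6 := abs_sub_le (partialProd D.f y n (D.f n (1 / (4 * D.q n))))
    (partialProd D.f y n (D.f n (-(1 / (4 * D.q n))))) (H (-(1 / (4 * D.q n))))
  rw [abs_sub_comm] at h2
  nlinarith [mul_nonneg (mul_nonneg (by linarith : (0 : ℝ) ≤ D.q n + 1)
    (by linarith : (0 : ℝ) ≤ D.q n - 2)) hp.le]

/-- Stage n is skipped, so H is within 2 c (n + 1) of a product whose inverse is q-Lipschitz. Points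
1/(2q) apart stay 1/(2q²) apart, and the two errors take away at most half of that. -/
theorem uncontracted_dist {H : CircleDeg1Lift} {x : ℕ → Bool}
    (hH : ∀ n t, |H t - partialProd D.f x n t| ≤ 2 * D.c n) {n : ℕ} (hn : 6 ≤ n)
    (hx : x n = false) (θ : ℝ) :
    1 / (4 * (D.q n : ℝ) ^ 2) ≤ dist ((H (θ + 1 / (4 * D.q n)) : ℝ) : UnitAddCircle)
      ((H (θ + -(1 / (4 * D.q n))) : ℝ) : UnitAddCircle) := by
  have hq := D.add_two_le_q n
  have hn' : (6 : ℝ) ≤ n := by exact_mod_cast hn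
  have hq0 : (0 : ℝ) < D.q n := by linarith
  have hc : 2 * D.c (n + 1) ≤ 1 / (8 * (D.q n : ℝ) ^ 2) := by
    have h1 := D.c_le n
    have h2 : (1 / (D.q n : ℝ)) ^ n ≤ (1 / D.q n) ^ 3 :=
      pow_le_pow_of_le_one (by positivity) ((div_le_one hq0).2 (by linarith)) (by omega)
    have h3 : (1 / (D.q n : ℝ)) ^ 3 ≤ 1 / (8 * (D.q n : ℝ) ^ 2) := by
      rw [one_div_pow]
      apply one_div_le_one_div_of_le (by positivity)
      nlinarith [sq_nonneg (D.q n : ℝ)]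
    linarith
  have key : ∀ s t : ℝ, 1 / (2 * (D.q n : ℝ)) ≤ s - t → 1 / (4 * (D.q n : ℝ) ^ 2) ≤ H s - H t := by
    intro s t hst
    have h1 := hH (n + 1) s
    have h2 := hH (n + 1) t
    rw [D.partialProd_succ_false hx] at h1 h2
    have h3 := D.antilipschitz x n s t
    have hst0 : t ≤ s := by
      have : 0 < 1 / (2 * (D.q n : ℝ)) := by positivity
      linarith
    have h4 : partialProd D.f x n t ≤ partialProd D.f x n s := CircleDeg1Lift.monotone _ hst0
    rw [abs_of_nonneg (sub_nonneg.2 hst0), abs_of_nonneg (sub_nonneg.2 h4)] at h3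
    have h5 : 1 / (2 * (D.q n : ℝ) ^ 2) ≤ partialProd D.f x n s - partialProd D.f x n t := by
      rw [div_le_iff₀ (by positivity)] at hst ⊢
      nlinarith
    have e1 : 1 / (2 * (D.q n : ℝ) ^ 2) = 1 / (4 * (D.q n : ℝ) ^ 2)
        + 1 / (8 * (D.q n : ℝ) ^ 2) + 1 / (8 * (D.q n : ℝ) ^ 2) := by
      field_simp
      norm_num
    have h6 := abs_le.1 h1
    have h7 := abs_le.1 h2
    linarith [h6.1, h7.2]
  have hab : 1 / (4 * (D.q n : ℝ)) = 1 / (2 * D.q n) / 2 := by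
    field_simp
    norm_num
  have hq1 : 1 / (2 * (D.q n : ℝ)) ≤ 1 / 2 := by
    apply one_div_le_one_div_of_le <;> linarith
  refine UnitAddCircle.le_dist_coe (key _ _ ?_) ?_
  · rw [hab]
    linarith
  -- Distance on the circle also requires the complementary arc to be long; it has length 1 - 1/(2q)
  -- ≥ 1/(2q), so the same estimate applies.
  · have h1 := key (θ + -(1 / (4 * D.q n)) + 1) (θ + 1 / (4 * D.q n)) (by rw [hab]; linarith)
    rw [CircleDeg1Lift.map_add_one] at h1
    linarith

theorem not_conjugateBy (hα : Irrational α) {x y : ℕ → Bool}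
    (hxy : ∃ᶠ n in atTop, x n = false ∧ y n = true) :
    ¬ ConjugateBy holderCircleHomeos (D.diffeo x).toHomeo (D.diffeo y).toHomeo := by
  rintro ⟨h, ⟨-, C, β, hβ, -, hC⟩, hconj⟩
  rw [D.diffeo_toHomeo, D.diffeo_toHomeo] at hconj
  obtain ⟨Hx, hxc, hxd, hxs⟩ := D.exists_semiconj x
  obtain ⟨Hy, hyc, hyd, hys⟩ := D.exists_semiconj y
  -- This phase θ makes h ∘ H_y and H_x ∘ R_θ agree at 0; both semiconjugate R_α to S_x, so
  -- irrationality forces them to coincide.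
  obtain ⟨θ, hθ⟩ : ∃ θ, ((Hx θ : ℝ) : UnitAddCircle) = h ((Hy 0 : ℝ) : UnitAddCircle) := by
    obtain ⟨s, hs⟩ := QuotientAddGroup.mk_surjective (h ((Hy 0 : ℝ) : UnitAddCircle))
    obtain ⟨θ, rfl⟩ := CircleDeg1Lift.continuous_iff_surjective Hx |>.1 hxc s
    exact ⟨θ, hs⟩
  have huv : (fun t => h ((Hy t : ℝ) : UnitAddCircle))
      = fun t => ((Hx (θ + t) : ℝ) : UnitAddCircle) := by
    refine eq_of_semiconj_irrational hα (circleHomeo (D.limit x)).injective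
      (h.continuous.comp ((AddCircle.continuous_mk' (1 : ℝ)).comp hyc))
      ((AddCircle.continuous_mk' (1 : ℝ)).comp (hxc.comp (by fun_prop))) (fun t => ?_)
      (fun t => ?_) (fun t => ?_) (fun t => ?_) ?_
    · simp
    · simp [← add_assoc]
    · rw [hconj, h.symm_apply_apply, circleHomeo_coe, hys]
    · rw [circleHomeo_coe, hxs, add_left_comm]
    · rw [add_zero, hθ]
  have hineq : ∀ n, 6 ≤ n → x n = false → y n = true →
      1 / (4 * (D.q n : ℝ) ^ 2) ≤ C * ((1 / (D.q n : ℝ)) ^ (n - 2)) ^ (β : ℝ) := by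
    intro n hn hxn hyn
    refine (D.uncontracted_dist hxd hn hxn θ).trans ?_
    have e : ∀ t, h ((Hy t : ℝ) : UnitAddCircle) = ((Hx (θ + t) : ℝ) : UnitAddCircle) :=
      fun t => congrFun huv t
    rw [← e, ← e]
    refine (hC.dist_le _ _).trans ?_
    gcongr
    exact (UnitAddCircle.dist_coe_le _ _).trans (D.contracted_dist hyd (by omega) hyn)
  -- With (n - 2)β ≥ 3 the Hölder bound is at most C q^{-3}; comparison with 1/(4q²) gives q ≤ 4C ≤
  -- n, against q ≥ n + 2.
  have hlarge : ∀ᶠ n : ℕ in atTop, 6 ≤ n ∧ 4 * (C : ℝ) ≤ n ∧ 3 ≤ ((n : ℝ) - 2) * β := by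
    have hβ' : (0 : ℝ) < β := hβ
    filter_upwards [eventually_ge_atTop 6,
      tendsto_natCast_atTop_atTop.eventually_ge_atTop (4 * (C : ℝ)),
      tendsto_natCast_atTop_atTop.eventually_ge_atTop (3 / (β : ℝ) + 2)] with n h1 h2 h3
    refine ⟨h1, h2, ?_⟩
    rw [← div_le_iff₀ hβ']
    linarith
  obtain ⟨n, ⟨hxn, hyn⟩, hn6, hnC, hnβ⟩ := (hxy.and_eventually hlarge).exists
  have h1 := hineq n hn6 hxn hyn
  have hq := D.add_two_le_q n
  have hq0 : (0 : ℝ) < D.q n := by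
    have : (0 : ℝ) ≤ n := n.cast_nonneg
    linarith
  have hq1 : (1 : ℝ) / D.q n ≤ 1 := by
    rw [div_le_one hq0]
    have : (0 : ℝ) ≤ n := n.cast_nonneg
    linarith
  have h2 : ((1 / (D.q n : ℝ)) ^ (n - 2)) ^ (β : ℝ) ≤ (1 / D.q n) ^ 3 := by
    rw [← Real.rpow_natCast, ← Real.rpow_mul (by positivity), ← Real.rpow_natCast _ 3]
    refine Real.rpow_le_rpow_of_exponent_ge (by positivity) hq1 ?_
    rw [Nat.cast_sub (by omega)]
    exact_mod_cast hnβ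
  have h3 := h1.trans (mul_le_mul_of_nonneg_left h2 C.coe_nonneg)
  have e : C * (1 / (D.q n : ℝ)) ^ 3 = 4 * C / D.q n * (1 / (4 * (D.q n : ℝ) ^ 2)) := by
    field_simp
  rw [e, le_mul_iff_one_le_left (by positivity), one_le_div hq0] at h3
  linarith

end ContractingSequence

end NotConjugate

/-! ### Tail invariance against non-conjugacy -/

theorem mainTheorem4 (α : ℝ) (hα : Liouville α)
    (𝒟 : Set (UnitAddCircle ≃ₜ UnitAddCircle)) (h𝒟 : IsRegularityClass 𝒟) :
    ¬ ∃ φ : SmoothCircleDiffeoOfRotation (α : UnitAddCircle) → ℝ,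
      IsCompleteNumericalBorelInvariant
        (fun S T : SmoothCircleDiffeoOfRotation (α : UnitAddCircle) =>
          ConjugateBy 𝒟 S.1.toHomeo T.1.toHomeo) φ := by
  rintro ⟨φ, hφ, hE⟩
  obtain ⟨D⟩ := hα.nonempty_contractingSequence
  let Ψ : (ℕ → Bool) → SmoothCircleDiffeoOfRotation (α : UnitAddCircle) := fun x =>
    ⟨D.diffeo x, D.hasRotationNumber_diffeo x⟩
  have hΨ : Continuous Ψ := D.continuous_diffeo.subtype_mk _
  have hm : Measurable fun x => φ (Ψ x) := by
    have h1 : @Measurable _ _ (borel _) (borel _) Ψ := hΨ.borel_measurable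
    have h2 : @Measurable _ _ (borel _) (borel ℝ) (φ ∘ Ψ) :=
      @Measurable.comp _ _ _ (_) (_) (_) _ _ hφ h1
    rwa [← BorelSpace.measurable_eq (α := ℕ → Bool), ← BorelSpace.measurable_eq (α := ℝ)] at h2
  obtain ⟨x, y, hxy, hfr⟩ := exists_eq_of_tail_invariant hm fun x y n h =>
    (hE _ _).1 (D.conjugateBy_of_eventually_eq h𝒟.1 h)
  obtain ⟨h, hh, hconj⟩ := (hE (Ψ x) (Ψ y)).2 hxy
  exact D.not_conjugateBy hα.irrational hfr ⟨h, h𝒟.2 hh, hconj⟩
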